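/- Let $\Omega\subset\mathbb R^N$ ($N\ge 1$) be a bounded open set. For $p>N$ let $\lambda_p$ be the first (smallest) eigenvalue of the $p$-Laplacian on $W^{1,p}_0(\Omega)$, i.e. the smallest $\lambda$ for which $-\mathrm{div}(|\nabla u|^{p-2}\nabla u)=\lambda|u|^{p-2}u$ has a non-zero distributional solution $u\in W^{1,p}_0(\Omega)$, and let $u_p$ be a corresponding eigenfunction which is positive in $\Omega$ with $\int_\Omega u_p^p\,dx=1$. Let $\Lambda_\infty\in\mathbb R$ and a finite positive Borel measure $f_\infty$ on $\overline\Omega$ be limits along some sequence of exponents $p\to\infty$: $\lambda_p^{1/p}\to\Lambda_\infty$ and $u_p^{p-1}\,dx\to f_\infty$ weakly-$*$ in the measures on $\overline\Omega$. Consider $$(\mathcal P_\infty)\qquad \min\Big\{-\int_{\overline\Omega} u\,df_\infty:\ u\in\mathrm{Lip}(\Omega),\ |\nabla u|\le\Lambda_\infty\ \text{a.e. in }\Omega,\ u=0\text{ on }\partial\Omega\Big\},$$ $$(\mathcal P_\infty^*)\qquad \min_{\lambda\in\mathcal P(\partial\Omega)}\ \min_{\sigma\in\mathcal M_b(\mathbb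 R^N)^N}\Big\{\Lambda_\infty\int_{\mathbb R^N}|\sigma|:\ -\mathrm{div}\,\sigma=f_\infty-\lambda\ \text{in }\mathbb R^N\Big\},$$ where $\mathcal P(\partial\Omega)$ is the set of Borel probability measures on $\partial\Omega$, $\mathcal M_b(\mathbb R^N)^N$ is the set of bounded $\mathbb R^N$-valued Borel measures, $|\sigma|$ is the total variation measure of $\sigma$ for the Euclidean norm, and $-\mathrm{div}\,\sigma=f_\infty-\lambda$ in $\mathbb R^N$ means $\int\nabla\varphi\cdot d\sigma=\int\varphi\,d(f_\infty-\lambda)$ for all $\varphi\in C_c^\infty(\mathbb R^N)$. Then all these minima are attained (the inner one for every $\lambda\in\mathcal P(\partial\Omega)$), and $$\min(\mathcal P_\infty)=-\min(\mathcal P_\infty^*).$$ Moreover $$\min(\mathcal P_\infty^*)=\min_{\sigma\in\mathcal M_b(\mathbb R^N)^N}\Big\{\Lambda_\infty\int_{\overline\Omega}|\sigma|:\ \mathrm{spt}(\sigma)\subset\overline\Omega,\ -\mathrm{div}\,\sigma\in\mathcal M_b(\mathbb R^N),\ -\mathrm{div}\,\sigma=f_\infty\ \text{in }\Omega\Big\},$$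 the last minimum being attained too, where $-\mathrm{div}\,\sigma\in\mathcal M_b(\mathbb R^N)$ means that the distributional divergence of $\sigma$ on $\mathbb R^N$ is a bounded signed measure, and $-\mathrm{div}\,\sigma=f_\infty$ in $\Omega$ means $\int\nabla\varphi\cdot d\sigma=\int\varphi\,df_\infty$ for all $\varphi\in C_c^\infty(\Omega)$. -/

import Mathlib

open MeasureTheory Filter Topology TopologicalSpace
open scoped Distributions RealInnerProductSpace Gradient BoundedContinuousFunction

noncomputable section

/-- The Euclidean space `ℝ^N`. -/
abbrev RN (N : ℕ) : Type := EuclideanSpace ℝ (Fin N)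

/-! ### The first eigenvalue of the `p`-Laplacian -/

/-- `G` is the weak gradient of `u` on `Ω`. -/
def IsWeakGradient {N : ℕ} (Ω : Opens (RN N)) (u : RN N → ℝ) (G : RN N → RN N) : Prop :=
  ∀ φ : 𝓓(Ω, ℝ), ∫ x in (Ω : Set (RN N)), u x • ∇ (φ : RN N → ℝ) x =
    - ∫ x in (Ω : Set (RN N)), φ x • G x

/-- `u ∈ W₀^{1,p}(Ω)` with weak gradient `G`: both are in `L^p(Ω)` and `u` is the limit in the
`W^{1,p}` norm of a sequence of test functions on `Ω`. -/
structure MemW01p {N : ℕ} (p : ℝ) (Ω : Opens (RN N)) (u : RN N → ℝ) (G : RN N → RN N) :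
    Prop where
  memLp : MemLp u (ENNReal.ofReal p) (volume.restrict (Ω : Set (RN N)))
  memLp_grad : MemLp G (ENNReal.ofReal p) (volume.restrict (Ω : Set (RN N)))
  isWeakGradient : IsWeakGradient Ω u G
  approx : ∃ φ : ℕ → 𝓓(Ω, ℝ),
    Tendsto (fun k => eLpNorm (fun x => φ k x - u x) (ENNReal.ofReal p)
      (volume.restrict (Ω : Set (RN N)))) atTop (𝓝 0) ∧
    Tendsto (fun k => eLpNorm (fun x => ∇ (φ k : RN N → ℝ) x - G x) (ENNReal.ofReal p)
      (volume.restrict (Ω : Set (RN N)))) atTop (𝓝 0)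

/-- `u ∈ W₀^{1,p}(Ω)` solves `-div (|∇u|^{p-2} ∇u) = lam |u|^{p-2} u` in the sense of
distributions in `Ω`. -/
def IsPLaplaceSolution {N : ℕ} (p : ℝ) (Ω : Opens (RN N)) (lam : ℝ) (u : RN N → ℝ) : Prop :=
  ∃ G : RN N → RN N, MemW01p p Ω u G ∧
    ∀ φ : 𝓓(Ω, ℝ),
      ∫ x in (Ω : Set (RN N)), ‖G x‖ ^ (p - 2) * ⟪G x, ∇ (φ : RN N → ℝ) x⟫ =
        lam * ∫ x in (Ω : Set (RN N)), |u x| ^ (p - 2) * u x * φ x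

/-- `lam` is an eigenvalue of the `p`-Laplacian: there is a non-zero solution. -/
def IsPLaplaceEigenvalue {N : ℕ} (p : ℝ) (Ω : Opens (RN N)) (lam : ℝ) : Prop :=
  ∃ u : RN N → ℝ, IsPLaplaceSolution p Ω lam u ∧
    ¬ (u =ᵐ[volume.restrict (Ω : Set (RN N))] 0)

/-- `lam` is the first, that is the smallest, eigenvalue of the `p`-Laplacian. -/
def IsFirstEigenvalue {N : ℕ} (p : ℝ) (Ω : Opens (RN N)) (lam : ℝ) : Prop :=
  IsLeast {l : ℝ | IsPLaplaceEigenvalue p Ω l} lam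

/-- `lam` is the first eigenvalue and `u` is a corresponding eigenfunction which is positive in
`Ω` and normalized in `L^p(Ω)`. -/
structure IsFirstEigenpair {N : ℕ} (p : ℝ) (Ω : Opens (RN N)) (lam : ℝ) (u : RN N → ℝ) :
    Prop where
  isFirst : IsFirstEigenvalue p Ω lam
  isSolution : IsPLaplaceSolution p Ω lam u
  pos : ∀ᵐ x ∂(volume.restrict (Ω : Set (RN N))), 0 < u x
  normalized : ∫ x in (Ω : Set (RN N)), u x ^ p = 1

/-- `Λ` and `f` (a finite positive measure on the closure of `Ω`) are limits obtained from the first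
eigenvalues and eigenfunctions along some sequence of exponents `p n > N` tending to infinity:
`(lam n)^{1/p n} → Λ`, and `(u n)^{p n - 1} dx → f` weakly-* in the measures on the closure. -/
def IsLimitAsPToInfty {N : ℕ} (Ω : Opens (RN N)) (f : Measure (RN N)) (Λ : ℝ) : Prop :=
  IsFiniteMeasure f ∧ f (closure (Ω : Set (RN N)))ᶜ = 0 ∧
  ∃ (p lam : ℕ → ℝ) (u : ℕ → RN N → ℝ),
    (∀ n, (N : ℝ) < p n) ∧ Tendsto p atTop atTop ∧
    (∀ n, IsFirstEigenpair (p n) Ω (lam n) (u n)) ∧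
    Tendsto (fun n => lam n ^ (1 / p n)) atTop (𝓝 Λ) ∧
    ∀ ψ : RN N →ᵇ ℝ,
      Tendsto (fun n => ∫ x in (Ω : Set (RN N)), ψ x * u n x ^ (p n - 1)) atTop
        (𝓝 (∫ x, ψ x ∂f))

/-! ### The limit problem -/

/-- `u ∈ Lip(Ω)` (extended by continuity to the closure), `u = 0` on `∂Ω` and `|∇u| ≤ Λ` almost
everywhere in `Ω`. -/
structure IsPrimalAdmissible {N : ℕ} (Ω : Opens (RN N)) (Λ : ℝ) (u : RN N → ℝ) : Prop where
  lipschitz : ∃ K : NNReal, LipschitzOnWith K u (closure (Ω : Set (RN N)))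
  boundary : ∀ x ∈ frontier (Ω : Set (RN N)), u x = 0
  gradient_le : ∀ᵐ x ∂(volume.restrict (Ω : Set (RN N))),
    DifferentiableAt ℝ u x ∧ ‖∇ u x‖ ≤ Λ

/-- The values `-⟨f, u⟩` taken in the limit problem. -/
def primalValues {N : ℕ} (Ω : Opens (RN N)) (f : Measure (RN N)) (Λ : ℝ) : Set ℝ :=
  {m | ∃ u : RN N → ℝ, IsPrimalAdmissible Ω Λ u ∧
    m = - ∫ x in closure (Ω : Set (RN N)), u x ∂f}

/-! ### The dual problem -/

/-- The Euclidean inner product of `ℝ^N` as a bounded bilinear map. -/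
def euclideanPairing (N : ℕ) : RN N →L[ℝ] RN N →L[ℝ] ℝ := innerSL ℝ

/-- `∫ ∇φ · dσ`. -/
def gradPairing {N : ℕ} (σ : VectorMeasure (RN N) (RN N)) (φ : RN N → ℝ) : ℝ :=
  ∫ᵛ x, ∇ φ x ∂[euclideanPairing N; σ]

/-- `σ` is a bounded vector measure. -/
def IsBoundedVectorMeasure {N : ℕ} (σ : VectorMeasure (RN N) (RN N)) : Prop :=
  IsFiniteMeasure σ.variation

/-- `ν` is a probability measure on `∂Ω`. -/
def IsBoundaryProbability {N : ℕ} (Ω : Opens (RN N)) (ν : Measure (RN N)) : Prop :=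
  IsProbabilityMeasure ν ∧ ν (frontier (Ω : Set (RN N)))ᶜ = 0

/-- The values `Λ ∫_{ℝ^N} |σ|` over bounded vector measures `σ` with `-div σ = f - ν` in `ℝ^N`, in
the sense of distributions. -/
def dualValues {N : ℕ} (f : Measure (RN N)) (Λ : ℝ) (ν : Measure (RN N)) : Set ℝ :=
  {m | ∃ σ : VectorMeasure (RN N) (RN N), IsBoundedVectorMeasure σ ∧
    (∀ φ : 𝓓((⊤ : Opens (RN N)), ℝ), gradPairing σ φ = ∫ x, φ x ∂f - ∫ x, φ x ∂ν) ∧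
    m = Λ * σ.variation.real Set.univ}

/-- The values `min {Λ ∫ |σ| : -div σ = f - ν in ℝ^N}`, for `ν` a probability measure on `∂Ω`. -/
def dualMinima {N : ℕ} (Ω : Opens (RN N)) (f : Measure (RN N)) (Λ : ℝ) : Set ℝ :=
  {m | ∃ ν : Measure (RN N), IsBoundaryProbability Ω ν ∧ IsLeast (dualValues f Λ ν) m}

/-- The values `Λ ∫_{closure Ω} |σ|` over bounded vector measures `σ` which are supported in the
closure of `Ω`, whose distributional divergence on `ℝ^N` is a bounded measure, and which satisfy
`-div σ = f` in `Ω` in the sense of distributions. -/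
def dualSupportedValues {N : ℕ} (Ω : Opens (RN N)) (f : Measure (RN N)) (Λ : ℝ) : Set ℝ :=
  {m | ∃ σ : VectorMeasure (RN N) (RN N), IsBoundedVectorMeasure σ ∧
    σ.variation.support ⊆ closure (Ω : Set (RN N)) ∧
    (∃ τ : SignedMeasure (RN N), ∀ φ : 𝓓((⊤ : Opens (RN N)), ℝ),
      gradPairing σ φ = ∫ᵛ x, φ x ∂•τ) ∧
    (∀ φ : 𝓓(Ω, ℝ), gradPairing σ φ = ∫ x, φ x ∂f) ∧
    m = Λ * σ.variation.real (closure (Ω : Set (RN N)))}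

end

/-! Write `d` for the distance to `∂Ω`. Every minimum in the duality is `Λ ∫ d df`, up to the sign
in the primal problem, as soon as `f` is a probability measure on the closure and `Λ ≥ 0`.

Primal side: the ball `B(x, d x)` lies in `Ω`, so the gradient bound along a segment to a nearest
boundary point gives `|u| ≤ Λ d` (`IsPrimalAdmissible.abs_le`), and `Λ d` itself is admissible.

Dual side: if `-div σ = f` in `Ω`, testing with smooth compactly supported approximations of `d`
gives `∫ d df ≤ |σ|(ℝ^N)` (`integral_infDist_le_variation`). Conversely, a test function with
gradient at most `a` on the closure and values at most `b` on `∂Ω` satisfies `φ ≤ a d + b`. Hence `φ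
↦ ∫ φ df` is dominated by a sublinear functional of its gradient and its boundary values, and
Hahn-Banach and Riesz produce `σ` of mass at most `∫ d df` together with a positive measure `ν` on
`∂Ω` (`exists_optimal_boundary`). The same device for a prescribed `ν`, with the
Kantorovich-Rubinstein supremum as constant, solves each inner problem
(`exists_isLeast_dualValues`).

The exponents `p` enter only to show that `f` has mass one and `Λ ≥ 0`. Young's inequality bounds `∫
u_p^{p-1}` above by `1 + |Ω|/p`. For the lower bound, the Sobolev inequality for `|u_p|^p` controls
`∫ u_p^{pκ}` by a power of `p` for some `κ > 1`. The part of `∫ u_p^p = 1` coming from `u_p > M > 1`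
therefore vanishes in the limit, so no mass is lost. -/

/-! ### Representation of dominated functionals by positive measures -/

/-- A linear functional on `C(X, ℝ)` dominated by `D * ‖h⁺‖` is the integral against a positive
measure of mass at most `D`. -/
theorem exists_measure_of_le_norm_posPart {X : Type*} [TopologicalSpace X] [CompactSpace X]
    [T2Space X] [MeasurableSpace X] [BorelSpace X] (T : C(X, ℝ) →ₗ[ℝ] ℝ) {D : ℝ} (hD : 0 ≤ D)
    (hT : ∀ h, T h ≤ D * ‖h ⊔ 0‖) :
    ∃ μ : Measure X, IsFiniteMeasure μ ∧ μ.real Set.univ ≤ D ∧ ∀ h : C(X, ℝ), T h = ∫ x, h x ∂μ := by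
  have hpos : ∀ h : C(X, ℝ), 0 ≤ h → 0 ≤ T h := by
    intro h hh
    -- For `h ≥ 0` the positive part of `-h` is zero, so the one-sided bound forces `T (-h) ≤ 0`.
    have h1 := hT (-h)
    rw [sup_eq_right.2 (neg_nonpos.2 hh), norm_zero, mul_zero, map_neg] at h1
    linarith
  let S : CompactlySupportedContinuousMap X ℝ →ₗ[ℝ] ℝ :=
    { toFun := fun h => T h.toContinuousMap
      map_add' := fun a b => map_add T a.toContinuousMap b.toContinuousMap
      map_smul' := fun c a => map_smul T c a.toContinuousMap }
  let P : CompactlySupportedContinuousMap X ℝ →ₚ[ℝ] ℝ :=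
    PositiveLinearMap.mk₀ S (fun h hh => hpos _ hh)
  have key : ∀ h : C(X, ℝ), T h = ∫ x, h x ∂(RealRMK.rieszMeasure P) := by
    intro h
    have := RealRMK.integral_rieszMeasure P (CompactlySupportedContinuousMap.continuousMapEquiv h)
    exact this.symm
  have hfin : IsFiniteMeasure (RealRMK.rieszMeasure P) :=
    ⟨isCompact_univ.measure_lt_top⟩
  refine ⟨_, hfin, ?_, key⟩
  have h1 := key 1
  simp only [ContinuousMap.one_apply, integral_const, smul_eq_mul, mul_one] at h1
  rw [← h1]
  refine (hT 1).trans (mul_le_of_le_one_right hD ?_)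
  rw [ContinuousMap.norm_le _ zero_le_one]
  intro x
  simp

theorem norm_add_sup_zero_le {X : Type*} [TopologicalSpace X] [CompactSpace X] (h k : C(X, ℝ)) :
    ‖(h + k) ⊔ 0‖ ≤ ‖h ⊔ 0‖ + ‖k ⊔ 0‖ := by
  rw [ContinuousMap.norm_le _ (by positivity)]
  intro x
  have h1 := ((h ⊔ 0 : C(X, ℝ))).norm_coe_le_norm x
  have h2 := ((k ⊔ 0 : C(X, ℝ))).norm_coe_le_norm x
  simp only [ContinuousMap.coe_sup, Pi.sup_apply, ContinuousMap.coe_zero, Pi.zero_apply,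
    ContinuousMap.coe_add, Pi.add_apply, Real.norm_eq_abs] at *
  rw [abs_of_nonneg (le_sup_right)] at *
  refine sup_le ?_ (by positivity)
  have := le_sup_left (a := h x) (b := 0)
  have := le_sup_left (a := k x) (b := 0)
  linarith

theorem norm_smul_sup_zero {X : Type*} [TopologicalSpace X] [CompactSpace X] {c : ℝ} (hc : 0 < c)
    (h : C(X, ℝ)) : ‖(c • h) ⊔ 0‖ = c * ‖h ⊔ 0‖ := by
  have : (c • h) ⊔ 0 = c • (h ⊔ 0) := by
    ext x
    simp only [ContinuousMap.coe_sup, Pi.sup_apply, ContinuousMap.coe_zero, Pi.zero_apply,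
      ContinuousMap.coe_smul, Pi.smul_apply, smul_eq_mul]
    rw [mul_max_of_nonneg _ _ hc.le, mul_zero]
  rw [this, norm_smul, Real.norm_of_nonneg hc.le]

/-- A linear functional dominated through two maps to spaces of continuous functions on compact
spaces is represented by a pair of positive measures. -/
theorem exists_measures_of_le_norm_posPart {V X Y : Type*} [AddCommGroup V] [Module ℝ V]
    [TopologicalSpace X] [CompactSpace X] [T2Space X] [MeasurableSpace X] [BorelSpace X]
    [TopologicalSpace Y] [CompactSpace Y] [T2Space Y] [MeasurableSpace Y] [BorelSpace Y]
    (A : V →ₗ[ℝ] C(X, ℝ)) (B : V →ₗ[ℝ] C(Y, ℝ)) (L : V →ₗ[ℝ] ℝ) {D E : ℝ} (hD : 0 ≤ D)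
    (hE : 0 ≤ E) (hL : ∀ v, L v ≤ D * ‖A v ⊔ 0‖ + E * ‖B v ⊔ 0‖) :
    ∃ (μ : Measure X) (ν : Measure Y), IsFiniteMeasure μ ∧ IsFiniteMeasure ν ∧
      μ.real Set.univ ≤ D ∧ ν.real Set.univ ≤ E ∧
      ∀ v, L v = ∫ x, A v x ∂μ + ∫ y, B v y ∂ν := by
  let J : V →ₗ[ℝ] C(X, ℝ) × C(Y, ℝ) := A.prod B
  -- The bound for `v` and `-v` makes `L` vanish on the kernel of `J = (A, B)`, so `L` descends to
  -- the range of `J`.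
  have hker : LinearMap.ker J ≤ LinearMap.ker L := by
    intro v hv
    have hv' : A v = 0 ∧ B v = 0 := by
      simpa [J, LinearMap.mem_ker, Prod.ext_iff] using hv
    have h1 := hL v
    have h2 := hL (-v)
    simp only [map_neg, hv'.1, hv'.2, neg_zero, sup_idem, norm_zero, mul_zero, add_zero] at h1 h2
    exact LinearMap.mem_ker.2 (by linarith)
  let F : LinearMap.range J →ₗ[ℝ] ℝ :=
    ((LinearMap.ker J).liftQ L hker).comp J.quotKerEquivRange.symm.toLinearMap
  have hF : ∀ v, F ⟨J v, LinearMap.mem_range_self J v⟩ = L v := by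
    intro v
    have : J.quotKerEquivRange.symm ⟨J v, LinearMap.mem_range_self J v⟩ =
        (LinearMap.ker J).mkQ v := by
      rw [LinearEquiv.symm_apply_eq]
      rfl
    simp [F, this]
  -- Hahn-Banach with a majorant built from positive parts only: this is what makes both components
  -- of the extension positive.
  obtain ⟨T, hT1, hT2⟩ := exists_extension_of_le_sublinear ⟨LinearMap.range J, F⟩
    (fun z => D * ‖z.1 ⊔ 0‖ + E * ‖z.2 ⊔ 0‖)
    (by
      intro c hc z
      simp only [Prod.smul_fst, Prod.smul_snd, norm_smul_sup_zero hc]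
      ring)
    (by
      intro z w
      have h1 := mul_le_mul_of_nonneg_left (norm_add_sup_zero_le z.1 w.1) hD
      have h2 := mul_le_mul_of_nonneg_left (norm_add_sup_zero_le z.2 w.2) hE
      simp only [Prod.fst_add, Prod.snd_add]
      linarith)
    (by
      rintro ⟨_, v, rfl⟩
      change F ⟨J v, _⟩ ≤ _
      rw [hF]
      exact hL v)
  obtain ⟨μ, hμ, hμD, hμT⟩ := exists_measure_of_le_norm_posPart (T.comp (LinearMap.inl ℝ _ _)) hD
    (fun h => by simpa using hT2 (h, 0))
  obtain ⟨ν, hν, hνE, hνT⟩ := exists_measure_of_le_norm_posPart (T.comp (LinearMap.inr ℝ _ _)) hE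
    (fun h => by simpa using hT2 (0, h))
  refine ⟨μ, ν, hμ, hν, hμD, hνE, fun v => ?_⟩
  rw [← hμT, ← hνT, ← hF v]
  have := hT1 ⟨J v, LinearMap.mem_range_self J v⟩
  change T (J v) = F _ at this
  rw [← this]
  simp [← map_add, J]

/-! ### Vector measures and their pairing with gradients -/

/-- Integrating against a vector measure with bounded density with respect to `μ`. -/
theorem integral_withDensityVec {X E F : Type*} [MeasurableSpace X] [NormedAddCommGroup E]
    [NormedSpace ℝ E] [NormedAddCommGroup F] [NormedSpace ℝ F] [CompleteSpace F]
    (B : E →L[ℝ] F →L[ℝ] ℝ) (μ : Measure X) [IsFiniteMeasure μ] {s : X → F}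
    (hs : AEStronglyMeasurable s μ) (hs1 : ∀ x, ‖s x‖ ≤ 1) {f : X → E} (hf : Integrable f μ) :
    ∫ᵛ x, f x ∂[B; μ.withDensityᵥ s] = ∫ x, B (f x) (s x) ∂μ := by
  have hsi : Integrable s μ := Integrable.of_bound hs 1 (ae_of_all _ hs1)
  have hvar : (μ.withDensityᵥ s).variation ≤ μ := by
    rw [Measure.variation_withDensityᵥ hsi]
    calc μ.withDensity (fun x => ‖s x‖ₑ) ≤ μ.withDensity 1 := by
          refine withDensity_mono (ae_of_all _ fun x => ?_)
          simpa [enorm_eq_nnnorm, ← NNReal.coe_le_coe] using hs1 x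
      _ = μ := withDensity_one
  have hint : ∀ g : X → E, Integrable g μ → (μ.withDensityᵥ s).Integrable g :=
    fun g hg => Integrable.mono_measure hg hvar
  have hBint : ∀ g : X → E, Integrable g μ → Integrable (fun x => B (g x) (s x)) μ := by
    intro g hg
    refine Integrable.mono' (hg.norm.const_mul ‖B‖)
      (B.aestronglyMeasurable_comp₂ hg.1 hs) (ae_of_all _ fun x => ?_)
    calc ‖B (g x) (s x)‖ ≤ ‖B‖ * ‖g x‖ * ‖s x‖ := B.le_opNorm₂ _ _
      _ ≤ ‖B‖ * ‖g x‖ * 1 := by gcongr; exact hs1 x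
      _ = _ := mul_one _
  -- Both sides are continuous in `L¹(μ)`, because the variation is at most `μ` and `‖s‖ ≤ 1`;
  -- indicators therefore suffice.
  refine Integrable.induction (μ := μ)
    (fun f => ∫ᵛ x, f x ∂[B; μ.withDensityᵥ s] = ∫ x, B (f x) (s x) ∂μ) ?_ ?_ ?_ ?_ hf
  · intro c A hA _
    rw [VectorMeasure.integral_indicator hA]
    have h1 : (fun x => B (A.indicator (fun _ => c) x) (s x)) = A.indicator (fun x => B c (s x)) := by
      ext x
      by_cases hx : x ∈ A <;> simp [hx]
    rw [h1, integral_indicator hA, (B c).integral_comp_comm hsi.integrableOn]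
    have : IsFiniteMeasure ((μ.withDensityᵥ s).restrict A).variation := by
      rw [VectorMeasure.variation_restrict hA]
      have : IsFiniteMeasure (μ.withDensityᵥ s).variation := isFiniteMeasure_of_le μ hvar
      infer_instance
    rw [VectorMeasure.integral_const]
    rw [VectorMeasure.restrict_apply _ hA MeasurableSet.univ, Set.univ_inter,
      withDensityᵥ_apply hsi hA]
  · intro f g _ hf hg h1 h2
    rw [VectorMeasure.integral_add (hint f hf) (hint g hg), h1, h2,
      ← integral_add (hBint f hf) (hBint g hg)]
    simp
  · refine isClosed_eq ?_ ?_
    · refine continuous_iff_continuousAt.2 fun g => ?_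
      refine VectorMeasure.tendsto_integral_of_L1 _ (hint _ (L1.integrable_coeFn g)).1
        (Eventually.of_forall fun f => hint _ (L1.integrable_coeFn f)) ?_
      have h0 : Tendsto (fun f : X →₁[μ] E => ∫⁻ x, ‖f x - g x‖ₑ ∂μ) (𝓝 g) (𝓝 0) := by
        have : Tendsto (fun f : X →₁[μ] E => edist f g) (𝓝 g) (𝓝 0) :=
          tendsto_iff_edist_tendsto_0.1 tendsto_id
        refine this.congr fun f => ?_
        rw [L1.edist_def]
        simp [edist_eq_enorm_sub]
      exact tendsto_of_tendsto_of_tendsto_of_le_of_le tendsto_const_nhds h0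
        (fun _ => zero_le) (fun f => lintegral_mono' hvar le_rfl)
    · refine continuous_iff_continuousAt.2 fun g => ?_
      refine tendsto_integral_of_L1 _ (hBint _ (L1.integrable_coeFn g)).1
        (Eventually.of_forall fun f => hBint _ (L1.integrable_coeFn f)) ?_
      have h0 : Tendsto (fun f : X →₁[μ] E => ‖B‖ₑ * ∫⁻ x, ‖f x - g x‖ₑ ∂μ) (𝓝 g) (𝓝 0) := by
        have : Tendsto (fun f : X →₁[μ] E => ‖B‖ₑ * edist f g) (𝓝 g) (𝓝 (‖B‖ₑ * 0)) :=
          ENNReal.Tendsto.const_mul (tendsto_iff_edist_tendsto_0.1 tendsto_id) (by simp)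
        rw [mul_zero] at this
        refine this.congr fun f => ?_
        rw [L1.edist_def]
        simp [edist_eq_enorm_sub]
      refine tendsto_of_tendsto_of_tendsto_of_le_of_le tendsto_const_nhds h0
        (fun _ => zero_le) (fun f => ?_)
      rw [← lintegral_const_mul' _ _ (by simp)]
      refine lintegral_mono fun x => ?_
      have h3 : B (f x) (s x) - B (g x) (s x) = B (f x - g x) (s x) := by simp
      rw [h3, enorm_eq_nnnorm, enorm_eq_nnnorm, enorm_eq_nnnorm]
      norm_cast
      have h4 : ‖B (f x - g x) (s x)‖ ≤ ‖B‖ * ‖f x - g x‖ :=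
        (B.le_opNorm₂ _ _).trans (mul_le_of_le_one_right (by positivity) (hs1 x))
      exact ENNReal.coe_le_coe.2 h4
  · intro f g hfg _ h
    have h1 : f =ᵐ[(μ.withDensityᵥ s).variation] g := (Measure.absolutelyContinuous_of_le hvar) hfg
    rw [← VectorMeasure.integral_congr_ae h1, h]
    refine integral_congr_ae ?_
    filter_upwards [hfg] with x hx
    rw [hx]

theorem inner_gradient_eq_fderiv {N : ℕ} (φ : RN N → ℝ) (x v : RN N) :
    ⟪∇ φ x, v⟫ = fderiv ℝ φ x v := by
  simp [gradient]

theorem norm_gradient_eq_norm_fderiv {N : ℕ} (φ : RN N → ℝ) (x : RN N) :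
    ‖∇ φ x‖ = ‖fderiv ℝ φ x‖ := by
  simp [gradient]

theorem TestFunction.continuous_gradient {N : ℕ} {Ω : Opens (RN N)} (φ : 𝓓(Ω, ℝ)) :
    Continuous (∇ (φ : RN N → ℝ)) :=
  (InnerProductSpace.toDual ℝ (RN N)).symm.continuous.comp
    (φ.contDiff.continuous_fderiv (by simp))

theorem TestFunction.hasCompactSupport_gradient {N : ℕ} {Ω : Opens (RN N)} (φ : 𝓓(Ω, ℝ)) :
    HasCompactSupport (∇ (φ : RN N → ℝ)) :=
  (φ.hasCompactSupport.fderiv (𝕜 := ℝ)).comp_left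
    (g := (InnerProductSpace.toDual ℝ (RN N)).symm) (map_zero _)

theorem abs_gradPairing_le {N : ℕ} {σ : VectorMeasure (RN N) (RN N)}
    (hσ : IsBoundedVectorMeasure σ) {φ : RN N → ℝ} {C : ℝ} (hφ : ∀ x, ‖∇ φ x‖ ≤ C) :
    |gradPairing σ φ| ≤ C * σ.variation.real Set.univ := by
  have : IsFiniteMeasure σ.variation := hσ
  refine (VectorMeasure.norm_integral_le_of_norm_le_const (μ := σ) (B := euclideanPairing N)
    (ae_of_all _ hφ)).trans ?_
  have hB : ‖euclideanPairing N‖ ≤ 1 := norm_innerSL_le ℝ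
  have hC : 0 ≤ C := (norm_nonneg _).trans (hφ 0)
  gcongr
  exact mul_le_of_le_one_right hC hB

/-- A vector measure carried by `K`, obtained by averaging the directions `s` of the unit ball. -/
theorem exists_vectorMeasure_of_measure {N : ℕ} {K : Set (RN N)} (hK : IsCompact K)
    (μ : Measure (K × Metric.closedBall (0 : RN N) 1)) [IsFiniteMeasure μ] :
    ∃ σ : VectorMeasure (RN N) (RN N), IsBoundedVectorMeasure σ ∧
      σ.variation.real Set.univ ≤ μ.real Set.univ ∧ σ.variation Kᶜ = 0 ∧
      ∀ φ : 𝓓((⊤ : Opens (RN N)), ℝ),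
        gradPairing σ φ = ∫ p, fderiv ℝ φ (p.1 : RN N) (p.2 : RN N) ∂μ := by
  have hm : Measurable (fun p : K × Metric.closedBall (0 : RN N) 1 => (p.1 : RN N)) := by fun_prop
  have hs : Measurable (fun p : K × Metric.closedBall (0 : RN N) 1 => (p.2 : RN N)) := by fun_prop
  have hs1 : ∀ p : K × Metric.closedBall (0 : RN N) 1, ‖(p.2 : RN N)‖ ≤ 1 :=
    fun p => mem_closedBall_zero_iff.1 p.2.2
  have hsi : Integrable (fun p : K × Metric.closedBall (0 : RN N) 1 => (p.2 : RN N)) μ :=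
    Integrable.of_bound hs.aestronglyMeasurable 1 (ae_of_all _ hs1)
  -- The required measure is the image of `s μ` under the projection `(x, s) ↦ x`; neither the
  -- density, bounded by 1, nor the projection increases mass.
  set τ := μ.withDensityᵥ (fun p : K × Metric.closedBall (0 : RN N) 1 => (p.2 : RN N))
  have hvar : τ.variation ≤ μ := by
    rw [Measure.variation_withDensityᵥ hsi]
    calc μ.withDensity _ ≤ μ.withDensity 1 := by
          refine withDensity_mono (ae_of_all _ fun x => ?_)
          simpa [enorm_eq_nnnorm, ← NNReal.coe_le_coe] using hs1 x
      _ = μ := withDensity_one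
  have hvar2 : (τ.map (fun p => (p.1 : RN N))).variation ≤ μ.map (fun p => (p.1 : RN N)) :=
    VectorMeasure.variation_map_le.trans (Measure.map_mono hvar hm)
  have hfin : IsFiniteMeasure (τ.map (fun p => (p.1 : RN N))).variation :=
    isFiniteMeasure_of_le _ hvar2
  refine ⟨τ.map (fun p => (p.1 : RN N)), hfin, ?_, ?_, fun φ => ?_⟩
  · refine ENNReal.toReal_mono (measure_ne_top _ _) ((hvar2 _).trans ?_)
    rw [Measure.map_apply hm MeasurableSet.univ, Set.preimage_univ]
  · refine le_antisymm ((hvar2 _).trans ?_) zero_le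
    rw [Measure.map_apply hm hK.measurableSet.compl]
    have : (fun p : K × Metric.closedBall (0 : RN N) 1 => (p.1 : RN N)) ⁻¹' Kᶜ = ∅ := by
      ext p
      simp
    rw [this, measure_empty]
  · obtain ⟨C, hC⟩ := φ.hasCompactSupport_gradient.exists_bound_of_continuous φ.continuous_gradient
    have hi : Integrable ((∇ (φ : RN N → ℝ)) ∘
        fun p : K × Metric.closedBall (0 : RN N) 1 => (p.1 : RN N)) μ :=
      Integrable.of_bound (φ.continuous_gradient.measurable.comp hm).aestronglyMeasurable C
        (ae_of_all _ fun p => hC _)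
    rw [gradPairing, VectorMeasure.integral_map hm
      φ.continuous_gradient.aestronglyMeasurable (Integrable.mono_measure hi hvar)]
    have := integral_withDensityVec (euclideanPairing N) μ hs.aestronglyMeasurable hs1 hi
    simp only [Function.comp_apply] at this
    rw [this]
    refine integral_congr_ae (ae_of_all _ fun p => ?_)
    exact inner_gradient_eq_fderiv _ _ _

/-- The pairing of the gradient of a test function with directions of the unit ball. -/
noncomputable def gradientOnBall {N : ℕ} (K : Set (RN N)) :
    𝓓((⊤ : Opens (RN N)), ℝ) →ₗ[ℝ] C(K × Metric.closedBall (0 : RN N) 1, ℝ) where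
  toFun φ := ⟨fun p => fderiv ℝ φ (p.1 : RN N) (p.2 : RN N), by
    have := φ.contDiff.continuous_fderiv (by simp)
    fun_prop⟩
  map_add' φ ψ := by
    ext p
    have h1 := φ.contDiff.differentiable (by simp) (p.1 : RN N)
    have h2 := ψ.contDiff.differentiable (by simp) (p.1 : RN N)
    simp [fderiv_add h1 h2]
  map_smul' c φ := by
    ext p
    have h1 := φ.contDiff.differentiable (by simp) (p.1 : RN N)
    simp [fderiv_const_smul h1]

/-- Restriction of test functions to a set. -/
noncomputable def testRestrict {N : ℕ} (S : Set (RN N)) : 𝓓((⊤ : Opens (RN N)), ℝ) →ₗ[ℝ] C(S, ℝ) where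
  toFun φ := ⟨fun p => φ (p : RN N), φ.continuous.comp continuous_subtype_val⟩
  map_add' φ ψ := by
    ext p
    simp
  map_smul' c φ := by
    ext p
    simp

/-- A functional on test functions controlled by the gradient on `K` and the values on `S` is the
sum of the divergence of a vector measure on `K` and of a positive measure on `S`. -/
theorem exists_vectorMeasure_and_measure {N : ℕ} {K S : Set (RN N)} (hK : IsCompact K)
    (hS : IsCompact S) (L : 𝓓((⊤ : Opens (RN N)), ℝ) →ₗ[ℝ] ℝ) {D E : ℝ} (hD : 0 ≤ D) (hE : 0 ≤ E)
    (hL : ∀ (φ : 𝓓((⊤ : Opens (RN N)), ℝ)) (a b : ℝ), 0 ≤ a → 0 ≤ b →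
      (∀ x ∈ K, ‖fderiv ℝ φ x‖ ≤ a) → (∀ x ∈ S, φ x ≤ b) → L φ ≤ D * a + E * b) :
    ∃ (σ : VectorMeasure (RN N) (RN N)) (ν : Measure (RN N)), IsBoundedVectorMeasure σ ∧
      σ.variation.real Set.univ ≤ D ∧ σ.variation Kᶜ = 0 ∧
      IsFiniteMeasure ν ∧ ν.real Set.univ ≤ E ∧ ν Sᶜ = 0 ∧
      ∀ φ : 𝓓((⊤ : Opens (RN N)), ℝ), L φ = gradPairing σ φ + ∫ x, φ x ∂ν := by
  have : CompactSpace K := isCompact_iff_compactSpace.1 hK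
  have : CompactSpace S := isCompact_iff_compactSpace.1 hS
  have : CompactSpace (Metric.closedBall (0 : RN N) 1) :=
    isCompact_iff_compactSpace.1 (isCompact_closedBall _ _)
  obtain ⟨μ, ν, hμ, hν, hμD, hνE, h⟩ := exists_measures_of_le_norm_posPart
    (gradientOnBall K) (testRestrict S) L hD hE (by
      intro φ
      refine hL φ _ _ (norm_nonneg _) (norm_nonneg _) (fun x hx => ?_) (fun x hx => ?_)
      -- The norm of the derivative is attained in the direction of the gradient. Where the gradient
      -- vanishes, `0⁻¹ = 0` selects the direction `0` and the bound is trivial.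
      · have hmem : ‖∇ (φ : RN N → ℝ) x‖⁻¹ • ∇ (φ : RN N → ℝ) x ∈
            Metric.closedBall (0 : RN N) 1 := by
          rw [mem_closedBall_zero_iff, norm_smul, norm_inv, norm_norm]
          exact inv_mul_le_one
        have h1 := (gradientOnBall K φ ⊔ 0).norm_coe_le_norm (⟨x, hx⟩, ⟨_, hmem⟩)
        refine le_trans ?_ ((le_abs_self _).trans h1)
        refine le_trans ?_ (le_sup_left (α := ℝ))
        change _ ≤ fderiv ℝ φ x (‖∇ (φ : RN N → ℝ) x‖⁻¹ • ∇ (φ : RN N → ℝ) x)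
        rw [← inner_gradient_eq_fderiv, inner_smul_right, real_inner_self_eq_norm_sq,
          ← norm_gradient_eq_norm_fderiv]
        by_cases h0 : ‖∇ (φ : RN N → ℝ) x‖ = 0
        · simp [h0]
        · rw [sq, inv_mul_cancel_left₀ h0]
      · have h1 := (testRestrict S φ ⊔ 0).norm_coe_le_norm ⟨x, hx⟩
        refine le_trans ?_ ((le_abs_self _).trans h1)
        exact le_sup_left (α := ℝ))
  obtain ⟨σ, hσ, hσμ, hσK, hσφ⟩ := exists_vectorMeasure_of_measure hK μ
  have hm : Measurable (fun p : S => (p : RN N)) := measurable_subtype_coe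
  refine ⟨σ, ν.map (fun p : S => (p : RN N)), hσ, hσμ.trans hμD, hσK,
    Measure.isFiniteMeasure_map ν _, ?_, ?_, fun φ => ?_⟩
  · rwa [measureReal_def, Measure.map_apply hm MeasurableSet.univ, Set.preimage_univ]
  · rw [Measure.map_apply hm hS.measurableSet.compl]
    have : (fun p : S => (p : RN N)) ⁻¹' Sᶜ = ∅ := by
      ext p
      simp
    rw [this, measure_empty]
  · rw [h, hσφ, integral_map hm.aemeasurable φ.continuous.aestronglyMeasurable]
    rfl

/-! ### Lipschitz functions and the distance to the boundary -/

/-- Compactly supported `1`-Lipschitz functions are uniform limits of `1`-Lipschitz test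
functions. -/
theorem exists_testFunction_of_lipschitzWith {N : ℕ} {Ω : Opens (RN N)} {w : RN N → ℝ}
    (hw : LipschitzWith 1 w) (hc : HasCompactSupport w) (hs : tsupport w ⊆ Ω) {ε : ℝ}
    (hε : 0 < ε) :
    ∃ φ : 𝓓(Ω, ℝ), (∀ x, ‖fderiv ℝ φ x‖ ≤ 1) ∧ ∀ x, |φ x - w x| ≤ ε := by
  obtain ⟨δ, hδ, hδΩ⟩ := hc.isCompact.exists_cthickening_subset_open Ω.isOpen hs
  have hr : 0 < min δ ε := lt_min hδ hε
  -- Mollification at scale below `δ` keeps the support in `Ω`; below `ε` it moves a `1`-Lipschitz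
  -- function by at most `ε`.
  let ρ : ContDiffBump (0 : RN N) := ⟨min δ ε / 2, min δ ε, half_pos hr, half_lt_self hr⟩
  let g : RN N → ℝ := convolution (ρ.normed volume) w (ContinuousLinearMap.lsmul ℝ ℝ) volume
  have hgdef : ∀ x, g x = ∫ t, ρ.normed volume t * w (x - t) := fun x => rfl
  have hint : ∀ x, Integrable (fun t => ρ.normed volume t * w (x - t)) := by
    intro x
    refine Continuous.integrable_of_hasCompactSupport ?_ ?_
    · exact ρ.continuous_normed.mul (hw.continuous.comp (continuous_const.sub continuous_id))
    · exact ρ.hasCompactSupport_normed.mul_right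
  have hsmooth : ContDiff ℝ (⊤ : ℕ∞) g :=
    (ρ.hasCompactSupport_normed (μ := volume)).contDiff_convolution_left (μ := volume) _
      (ρ.contDiff_normed (μ := volume))
      (hw.continuous.locallyIntegrable (μ := volume))
  have hlip : LipschitzWith 1 g := by
    refine LipschitzWith.of_dist_le_mul fun x y => ?_
    rw [NNReal.coe_one, one_mul, Real.dist_eq, hgdef, hgdef, ← integral_sub (hint x) (hint y)]
    calc |∫ t, ρ.normed volume t * w (x - t) - ρ.normed volume t * w (y - t)|
        ≤ ∫ t, ρ.normed volume t * dist x y := by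
          rw [← Real.norm_eq_abs]
          refine norm_integral_le_of_norm_le
            ((ρ.integrable_normed (μ := volume)).mul_const _)
            (ae_of_all _ fun t => ?_)
          rw [← mul_sub, Real.norm_eq_abs, abs_mul, abs_of_nonneg (ρ.nonneg_normed t)]
          refine mul_le_mul_of_nonneg_left ?_ (ρ.nonneg_normed t)
          have := hw.dist_le_mul (x - t) (y - t)
          simpa [Real.dist_eq] using this
      _ = dist x y := by rw [integral_mul_const, ρ.integral_normed, one_mul]
  have hsupp : tsupport g ⊆ Metric.cthickening δ (tsupport w) := by
    refine closure_minimal (fun x hx => ?_) Metric.isClosed_cthickening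
    obtain ⟨a, ha, b, hb, rfl⟩ := support_convolution_subset _ hx
    rw [ρ.support_normed_eq] at ha
    refine Metric.mem_cthickening_of_dist_le _ b _ _ (subset_tsupport _ hb) ?_
    have : ‖a‖ < min δ ε := by simpa [ρ] using ha
    simpa using this.le.trans (min_le_left _ _)
  refine ⟨⟨g, hsmooth, ?_, hsupp.trans hδΩ⟩, fun x => ?_, fun x => ?_⟩
  · exact IsCompact.of_isClosed_subset hc.isCompact.cthickening (isClosed_tsupport _) hsupp
  · have h := norm_fderiv_le_of_lipschitz ℝ (x₀ := x) hlip
    rwa [NNReal.coe_one] at h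
  · change |g x - w x| ≤ ε
    rw [← Real.dist_eq]
    refine ρ.dist_normed_convolution_le hw.continuous.aestronglyMeasurable fun y hy => ?_
    have h1 := hw.dist_le_mul y x
    have h2 : dist y x < min δ ε := hy
    rw [NNReal.coe_one, one_mul] at h1
    exact h1.trans (h2.le.trans (min_le_right _ _))

/-- A Lipschitz function whose derivative is bounded by `Λ` almost everywhere in a ball satisfies
the corresponding Lipschitz bound in this ball. -/
theorem LipschitzWith.abs_sub_le_of_ae_norm_fderiv_le {N : ℕ} {K : NNReal} {g : RN N → ℝ}
    (hg : LipschitzWith K g) {c : RN N} {r Λ : ℝ}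
    (hΛ : ∀ᵐ x, x ∈ Metric.ball c r → DifferentiableAt ℝ g x ∧ ‖fderiv ℝ g x‖ ≤ Λ) {x y : RN N}
    (hx : x ∈ Metric.ball c r) (hy : y ∈ Metric.ball c r) : |g y - g x| ≤ Λ * ‖y - x‖ := by
  set v := y - x with hv
  obtain ⟨T, hT, hTm, hT0⟩ := exists_measurable_superset_of_null (ae_iff.1 hΛ)
  have hgood : ∀ z ∉ T, z ∈ Metric.ball c r → DifferentiableAt ℝ g z ∧ ‖fderiv ℝ g z‖ ≤ Λ := by
    intro z hz
    by_contra h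
    exact hz (hT h)
  -- The exceptional set is null but may contain a whole segment. By Fubini, almost every translate
  -- of the segment meets it in a null set of parameters, and the fundamental theorem of calculus
  -- applies there.
  have h1 : ∀ t : ℝ, ∀ᵐ z : RN N, z + t • v ∉ T := by
    intro t
    have := (measurePreserving_add_right (volume : Measure (RN N)) (t • v)).quasiMeasurePreserving
    exact this.ae (compl_mem_ae_iff.2 hT0)
  have h2 : ∀ᵐ z : RN N, ∀ᵐ t : ℝ, z + t • v ∉ T := by
    rw [Measure.ae_ae_comm]
    · exact ae_of_all _ h1
    · have : Measurable fun p : RN N × ℝ => p.1 + p.2 • v := by fun_prop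
      exact this hTm.compl
  have h3 : ∀ᵐ z : RN N, z ∈ Metric.ball c r → z + v ∈ Metric.ball c r →
      |g (z + v) - g z| ≤ Λ * ‖v‖ := by
    filter_upwards [h2] with z hz hz1 hz2
    let h : ℝ → ℝ := fun t => g (z + t • v)
    have hlip : LipschitzWith (K * ‖v‖₊) h := by
      refine LipschitzWith.of_dist_le_mul fun s t => (hg.dist_le_mul _ _).trans_eq ?_
      rw [dist_add_left, dist_eq_norm, ← sub_smul, norm_smul, Real.dist_eq, Real.norm_eq_abs]
      push_cast
      ring
    have hac := hlip.lipschitzOnWith (s := Set.uIcc (0 : ℝ) 1) |>.absolutelyContinuousOnInterval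
    have hftc := hac.integral_deriv_eq_sub
    have hb : ‖∫ t in (0 : ℝ)..1, deriv h t‖ ≤ Λ * ‖v‖ * |1 - 0| := by
      refine intervalIntegral.norm_integral_le_of_norm_le_const_ae ?_
      filter_upwards [hz] with t ht htI
      rw [Set.uIoc_of_le zero_le_one] at htI
      have hmem : z + t • v ∈ Metric.ball c r := by
        have := (convex_ball c r).add_smul_sub_mem hz1 hz2 (t := t) ⟨htI.1.le, htI.2⟩
        simpa using this
      obtain ⟨hd, hle⟩ := hgood _ ht hmem
      have hd' : HasDerivAt h (fderiv ℝ g (z + t • v) v) t := by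
        have hl : HasDerivAt (fun t : ℝ => z + t • v) v t := by
          simpa using ((hasDerivAt_id t).smul_const v).const_add z
        exact hd.hasFDerivAt.comp_hasDerivAt t hl
      rw [hd'.deriv]
      exact (fderiv ℝ g _).le_of_opNorm_le hle v
    rw [hftc] at hb
    simpa [h] using hb
  -- By continuity a violation at `x` persists on a nonempty open set, which has positive measure
  -- and contradicts the almost everywhere bound.
  by_contra hcon
  have hcont : Continuous fun z => |g (z + v) - g z| :=
    ((hg.continuous.comp (continuous_id.add continuous_const)).sub hg.continuous).abs
  have hopen : IsOpen (Metric.ball c r ∩ ((fun z => z + v) ⁻¹' Metric.ball c r ∩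
      {z | |g (z + v) - g z| ≤ Λ * ‖v‖}ᶜ)) :=
    Metric.isOpen_ball.inter ((Metric.isOpen_ball.preimage (continuous_add_const v)).inter
      (isClosed_le hcont continuous_const).isOpen_compl)
  have hpos := hopen.measure_pos volume ⟨x, hx, by simpa [hv] using hy, by
    rw [Set.mem_compl_iff, Set.mem_ofPred_eq, hv, add_sub_cancel]
    exact hcon⟩
  refine hpos.ne' (measure_mono_null (fun z hz => ?_) (ae_iff.1 h3))
  exact fun hh => hz.2.2 (hh hz.1 hz.2.1)

theorem frontier_nonempty_of_isBounded {N : ℕ} (hN : 0 < N) {Ω : Set (RN N)} (hne : Ω.Nonempty)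
    (hΩ : Bornology.IsBounded Ω) : (frontier Ω).Nonempty := by
  have : Nonempty (Fin N) := ⟨⟨0, hN⟩⟩
  rw [nonempty_frontier_iff]
  refine ⟨hne, fun h => ?_⟩
  rw [h] at hΩ
  exact NormedSpace.unbounded_univ ℝ (RN N) hΩ

/-- The ball is connected and misses the frontier, so it lies entirely in `Ω` or entirely in the
exterior; its centre decides which. -/
theorem ball_infDist_frontier_subset {N : ℕ} {Ω : Set (RN N)} (hΩ : IsOpen Ω) {x : RN N}
    (hx : x ∈ Ω) : Metric.ball x (Metric.infDist x (frontier Ω)) ⊆ Ω := by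
  intro y hy
  have hpos : 0 < Metric.infDist x (frontier Ω) := dist_nonneg.trans_lt hy
  have hcov : Metric.ball x (Metric.infDist x (frontier Ω)) ⊆ Ω ∪ (closure Ω)ᶜ := by
    intro z hz
    by_contra h
    rw [Set.mem_union, not_or, Set.notMem_compl_iff] at h
    have hzf : z ∈ frontier Ω := by
      rw [hΩ.frontier_eq]
      exact ⟨h.2, h.1⟩
    have := Metric.infDist_le_dist_of_mem (x := x) hzf
    rw [dist_comm] at this
    exact absurd hz (not_lt.2 this)
  refine IsPreconnected.subset_left_of_subset_union hΩ isClosed_closure.isOpen_compl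
    (Set.disjoint_compl_right_iff_subset.2 subset_closure) hcov
    ⟨x, Metric.mem_ball_self hpos, hx⟩ (convex_ball _ _).isPreconnected hy

/-- No convexity of `Ω` is needed: the gradient bound is integrated only inside the largest ball
about `x` contained in `Ω`, towards a nearest boundary point, where `u` vanishes. -/
theorem IsPrimalAdmissible.abs_le {N : ℕ} {Ω : Opens (RN N)} {Λ : ℝ} {u : RN N → ℝ}
    (hu : IsPrimalAdmissible Ω Λ u) (hfr : (frontier (Ω : Set (RN N))).Nonempty) {x : RN N}
    (hx : x ∈ closure (Ω : Set (RN N))) :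
    |u x| ≤ Λ * Metric.infDist x (frontier (Ω : Set (RN N))) := by
  by_cases hxΩ : x ∉ Ω
  · have hxf : x ∈ frontier (Ω : Set (RN N)) := by
      rw [Ω.isOpen.frontier_eq]
      exact ⟨hx, hxΩ⟩
    rw [hu.boundary x hxf, Metric.infDist_zero_of_mem hxf]
    simp
  push Not at hxΩ
  obtain ⟨K, hK⟩ := hu.lipschitz
  obtain ⟨g, hg, hgu⟩ := hK.extend_real
  set d := Metric.infDist x (frontier (Ω : Set (RN N))) with hd
  have hball : Metric.ball x d ⊆ Ω := ball_infDist_frontier_subset Ω.isOpen hxΩ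
  obtain ⟨y, hyf, hy⟩ := isClosed_frontier.exists_infDist_eq_dist hfr x
  have hdpos : 0 < d :=
    (isClosed_frontier.notMem_iff_infDist_pos hfr).1 fun h => h.2 (by rwa [Ω.isOpen.interior_eq])
  have hae : ∀ᵐ z, z ∈ Metric.ball x d → DifferentiableAt ℝ g z ∧ ‖fderiv ℝ g z‖ ≤ Λ := by
    filter_upwards [(ae_restrict_iff' Ω.isOpen.measurableSet).1 hu.gradient_le] with z hz hzb
    have hzΩ := hball hzb
    obtain ⟨h1, h2⟩ := hz hzΩ
    have heq : u =ᶠ[𝓝 z] g := by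
      filter_upwards [Ω.isOpen.mem_nhds hzΩ] with w hw
      exact hgu (subset_closure hw)
    rw [norm_gradient_eq_norm_fderiv] at h2
    exact ⟨(heq.differentiableAt_iff (𝕜 := ℝ)).1 h1, heq.fderiv_eq (𝕜 := ℝ) ▸ h2⟩
  -- The nearest boundary point lies on the sphere, outside the open ball, so it is reached only in
  -- the limit `t → 1`.
  have hlt : ∀ t ∈ Set.Ico (0 : ℝ) 1, |g (x + t • (y - x)) - g x| ≤ Λ * (t * d) := by
    intro t ht
    have hn : ‖t • (y - x)‖ = t * d := by
      rw [norm_smul, Real.norm_of_nonneg ht.1, ← dist_eq_norm, dist_comm, ← hy]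
    have := hg.abs_sub_le_of_ae_norm_fderiv_le hae (Metric.mem_ball_self hdpos)
      (y := x + t • (y - x)) (by
        rw [Metric.mem_ball, dist_eq_norm, add_sub_cancel_left, hn]
        exact mul_lt_of_lt_one_left hdpos ht.2)
    rwa [add_sub_cancel_left, hn] at this
  have hlim : |g (x + (1 : ℝ) • (y - x)) - g x| ≤ Λ * (1 * d) := by
    have hc := hg.continuous
    have h1 : Tendsto (fun t : ℝ => |g (x + t • (y - x)) - g x|) (𝓝[<] 1)
        (𝓝 |g (x + (1 : ℝ) • (y - x)) - g x|) :=
      (Continuous.tendsto (by fun_prop) _).mono_left nhdsWithin_le_nhds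
    have h2 : Tendsto (fun t : ℝ => Λ * (t * d)) (𝓝[<] 1) (𝓝 (Λ * (1 * d))) :=
      (Continuous.tendsto (by fun_prop) _).mono_left nhdsWithin_le_nhds
    refine le_of_tendsto_of_tendsto h1 h2 ?_
    filter_upwards [Ico_mem_nhdsLT zero_lt_one] with t ht using hlt t ht
  have hgy : g y = 0 := by rw [← hgu (frontier_subset_closure hyf), hu.boundary y hyf]
  have hgx : u x = g x := hgu hx
  rw [one_smul, one_mul, add_sub_cancel, hgy, zero_sub, abs_neg] at hlim
  rwa [hgx]

theorem isPrimalAdmissible_infDist {N : ℕ} (Ω : Opens (RN N)) {Λ : ℝ} (hΛ : 0 ≤ Λ) :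
    IsPrimalAdmissible Ω Λ (fun x => Λ * Metric.infDist x (frontier (Ω : Set (RN N)))) := by
  have hlip : LipschitzWith Λ.toNNReal
      (fun x : RN N => Λ * Metric.infDist x (frontier (Ω : Set (RN N)))) := by
    refine LipschitzWith.of_dist_le_mul fun x y => ?_
    have := (Metric.lipschitz_infDist_pt (frontier (Ω : Set (RN N)))).dist_le_mul x y
    rw [Real.coe_toNNReal _ hΛ, Real.dist_eq, ← mul_sub, abs_mul, abs_of_nonneg hΛ, ← Real.dist_eq]
    refine mul_le_mul_of_nonneg_left ?_ hΛ
    simpa using this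
  refine ⟨⟨_, hlip.lipschitzOnWith⟩, fun x hx => ?_, ae_restrict_of_ae ?_⟩
  · simp [Metric.infDist_zero_of_mem hx]
  · filter_upwards [hlip.ae_differentiableAt] with x hx
    refine ⟨hx, ?_⟩
    rw [norm_gradient_eq_norm_fderiv]
    simpa [hΛ] using norm_fderiv_le_of_lipschitz ℝ (x₀ := x) hlip

/-- The distance to the complement vanishes outside `Ω`, unlike the distance to the frontier, so it
can be truncated to compact support in `Ω`. This comparison allows the exchange. -/
theorem infDist_frontier_le_infDist_compl {N : ℕ} {Ω : Set (RN N)} (hΩ : IsOpen Ω)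
    (hne : Ωᶜ.Nonempty) {x : RN N} (hx : x ∈ closure Ω) :
    Metric.infDist x (frontier Ω) ≤ Metric.infDist x Ωᶜ := by
  by_cases hxΩ : x ∈ Ω
  · refine (Metric.le_infDist hne).2 fun y hy => ?_
    by_contra h
    rw [not_le, dist_comm] at h
    exact hy (ball_infDist_frontier_subset hΩ hxΩ h)
  · rw [Metric.infDist_zero_of_mem (by rw [hΩ.frontier_eq]; exact ⟨hx, hxΩ⟩)]
    exact Metric.infDist_nonneg

theorem TestFunction.integrable_of_isFiniteMeasure {N : ℕ} {Ω : Opens (RN N)} (φ : 𝓓(Ω, ℝ))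
    (μ : Measure (RN N)) [IsFiniteMeasure μ] : Integrable φ μ :=
  φ.continuous.integrable_of_hasCompactSupport φ.hasCompactSupport

theorem integrable_of_continuous_of_measure_compl_closure {N : ℕ} {Ω : Set (RN N)}
    (hΩ : Bornology.IsBounded Ω) {μ : Measure (RN N)} [IsFiniteMeasure μ]
    (hμ : μ (closure Ω)ᶜ = 0) {g : RN N → ℝ} (hg : Continuous g) : Integrable g μ := by
  obtain ⟨C, hC⟩ := hΩ.isCompact_closure.exists_bound_of_continuousOn hg.continuousOn
  refine Integrable.of_bound hg.aestronglyMeasurable C ?_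
  filter_upwards [compl_mem_ae_iff.2 hμ] with x hx
  exact hC x (by simpa using hx)

/-! ### The two bounds in the dual problem -/

/-- Lower bound for the mass of a vector measure with `-div σ = f` in `Ω`. -/
theorem integral_infDist_le_variation {N : ℕ} (Ω : Opens (RN N))
    (hΩ : Bornology.IsBounded (Ω : Set (RN N))) (hne : ((Ω : Set (RN N))ᶜ).Nonempty)
    {f : Measure (RN N)} [IsProbabilityMeasure f] (hf : f (closure (Ω : Set (RN N)))ᶜ = 0)
    {σ : VectorMeasure (RN N) (RN N)} (hσ : IsBoundedVectorMeasure σ)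
    (hdiv : ∀ φ : 𝓓(Ω, ℝ), gradPairing σ φ = ∫ x, φ x ∂f) :
    ∫ x, Metric.infDist x (frontier (Ω : Set (RN N))) ∂f ≤ σ.variation.real Set.univ := by
  have hcd : Continuous fun x : RN N => Metric.infDist x (Ω : Set (RN N))ᶜ :=
    Metric.continuous_infDist_pt _
  have hid : Integrable (fun x : RN N => Metric.infDist x (Ω : Set (RN N))ᶜ) f :=
    integrable_of_continuous_of_measure_compl_closure hΩ hf hcd
  have h1 : ∫ x, Metric.infDist x (frontier (Ω : Set (RN N))) ∂f ≤
      ∫ x, Metric.infDist x (Ω : Set (RN N))ᶜ ∂f := by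
    refine integral_mono_ae (integrable_of_continuous_of_measure_compl_closure hΩ hf
      (Metric.continuous_infDist_pt _)) hid ?_
    filter_upwards [compl_mem_ae_iff.2 hf] with x hx
    exact infDist_frontier_le_infDist_compl Ω.isOpen hne (by simpa using hx)
  refine h1.trans (le_of_forall_pos_le_add fun ε hε => ?_)
  -- Lowering the distance by `ε / 2` pushes the support into `Ω`; smoothing costs the other `ε /
  -- 2`.
  have hlip : LipschitzWith 1 fun x : RN N => max (Metric.infDist x (Ω : Set (RN N))ᶜ - ε / 2) 0 := by
    have := ((Metric.lipschitz_infDist_pt (Ω : Set (RN N))ᶜ).sub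
      (LipschitzWith.const (ε / 2))).max_const 0
    simpa using this
  have hsub : tsupport (fun x : RN N => max (Metric.infDist x (Ω : Set (RN N))ᶜ - ε / 2) 0) ⊆ Ω := by
    have hcl : IsClosed {x : RN N | ε / 2 ≤ Metric.infDist x (Ω : Set (RN N))ᶜ} :=
      isClosed_le continuous_const hcd
    refine (closure_minimal (t := {x : RN N | ε / 2 ≤ Metric.infDist x (Ω : Set (RN N))ᶜ})
      (fun x hx => ?_) hcl).trans fun x hx => ?_
    · by_contra h
      refine hx (max_eq_right ?_)
      have : Metric.infDist x (Ω : Set (RN N))ᶜ < ε / 2 := not_le.1 h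
      linarith
    · by_contra h
      have h0 : Metric.infDist x (Ω : Set (RN N))ᶜ = 0 := Metric.infDist_zero_of_mem h
      have h2 : ε / 2 ≤ Metric.infDist x (Ω : Set (RN N))ᶜ := hx
      linarith
  have hcomp : HasCompactSupport fun x : RN N =>
      max (Metric.infDist x (Ω : Set (RN N))ᶜ - ε / 2) 0 :=
    Metric.isCompact_of_isClosed_isBounded (isClosed_tsupport _) (hΩ.subset hsub)
  obtain ⟨φ, hφ1, hφ⟩ := exists_testFunction_of_lipschitzWith hlip hcomp hsub (half_pos hε)
  have h3 := abs_gradPairing_le hσ (φ := φ) (C := 1) fun x => by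
    rw [norm_gradient_eq_norm_fderiv]
    exact hφ1 x
  rw [hdiv, one_mul] at h3
  have h4 : ∫ x, (Metric.infDist x (Ω : Set (RN N))ᶜ - ε) ∂f ≤ ∫ x, φ x ∂f := by
    refine integral_mono (hid.sub (integrable_const _)) (φ.integrable_of_isFiniteMeasure f)
      fun x => ?_
    have h5 := (abs_le.1 (hφ x)).1
    have h6 := le_max_left (Metric.infDist x (Ω : Set (RN N))ᶜ - ε / 2) 0
    change Metric.infDist x (Ω : Set (RN N))ᶜ - ε ≤ φ x
    linarith
  rw [integral_sub hid (integrable_const _), integral_const, probReal_univ, one_smul] at h4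
  have := le_abs_self (∫ x, φ x ∂f)
  linarith

/-- Extension by zero of a test function. -/
theorem TestFunction.exists_eq_of_le {N : ℕ} {Ω : Opens (RN N)} (φ : 𝓓(Ω, ℝ)) :
    ∃ ψ : 𝓓((⊤ : Opens (RN N)), ℝ), (ψ : RN N → ℝ) = φ :=
  ⟨⟨φ, φ.contDiff, φ.hasCompactSupport, fun _ _ => trivial⟩, rfl⟩

/-- Test functions of `Ω` vanish on `∂Ω`, so they do not see `ν`. -/
theorem gradPairing_eq_of_boundary {N : ℕ} {Ω : Opens (RN N)} {f ν : Measure (RN N)}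
    (hν : ν (frontier (Ω : Set (RN N)))ᶜ = 0) {σ : VectorMeasure (RN N) (RN N)}
    (hdiv : ∀ φ : 𝓓((⊤ : Opens (RN N)), ℝ), gradPairing σ φ = ∫ x, φ x ∂f - ∫ x, φ x ∂ν)
    (φ : 𝓓(Ω, ℝ)) : gradPairing σ φ = ∫ x, φ x ∂f := by
  obtain ⟨ψ, hψ⟩ := φ.exists_eq_of_le
  have h := hdiv ψ
  rw [hψ] at h
  rw [h, sub_eq_self]
  refine integral_eq_zero_of_ae ?_
  filter_upwards [compl_mem_ae_iff.2 hν] with x hx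
  have hx' : x ∈ frontier (Ω : Set (RN N)) := by simpa using hx
  rw [Ω.isOpen.frontier_eq] at hx'
  exact image_eq_zero_of_notMem_tsupport fun hh => hx'.2 (φ.tsupport_subset hh)

theorem exists_testFunction_eq_one {N : ℕ} {K : Set (RN N)} (hK : Bornology.IsBounded K) :
    ∃ φ : 𝓓((⊤ : Opens (RN N)), ℝ), (∀ x ∈ K, φ x = 1) ∧ ∀ x ∈ K, ∇ (φ : RN N → ℝ) x = 0 := by
  obtain ⟨R, hR, hKR⟩ := hK.subset_ball_lt 0 (0 : RN N)
  let b : ContDiffBump (0 : RN N) := ⟨R, R + 1, hR, by linarith⟩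
  refine ⟨⟨b, b.contDiff, b.hasCompactSupport, fun _ _ => trivial⟩, fun x hx => ?_, fun x hx => ?_⟩
  · exact b.one_of_mem_closedBall (Metric.ball_subset_closedBall (hKR hx))
  · have h : (b : RN N → ℝ) =ᶠ[𝓝 x] fun _ => 1 := by
      filter_upwards [Metric.isOpen_ball.mem_nhds (hKR hx)] with y hy
      exact b.one_of_mem_closedBall (Metric.ball_subset_closedBall hy)
    change ∇ (b : RN N → ℝ) x = 0
    rw [gradient, h.fderiv_eq]
    simp

/-- An optimal boundary measure together with an optimal vector measure. -/
theorem exists_optimal_boundary {N : ℕ} (Ω : Opens (RN N))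
    (hΩ : Bornology.IsBounded (Ω : Set (RN N))) (hfr : (frontier (Ω : Set (RN N))).Nonempty)
    {f : Measure (RN N)} [IsProbabilityMeasure f] (hf : f (closure (Ω : Set (RN N)))ᶜ = 0) :
    ∃ (ν : Measure (RN N)) (σ : VectorMeasure (RN N) (RN N)), IsBoundaryProbability Ω ν ∧
      IsBoundedVectorMeasure σ ∧ σ.variation (closure (Ω : Set (RN N)))ᶜ = 0 ∧
      σ.variation.real Set.univ ≤ ∫ x, Metric.infDist x (frontier (Ω : Set (RN N))) ∂f ∧
      ∀ φ : 𝓓((⊤ : Opens (RN N)), ℝ), gradPairing σ φ = ∫ x, φ x ∂f - ∫ x, φ x ∂ν := by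
  set d : RN N → ℝ := fun x => Metric.infDist x (frontier (Ω : Set (RN N))) with hd
  have hdi : Integrable d f := integrable_of_continuous_of_measure_compl_closure hΩ hf
    (Metric.continuous_infDist_pt _)
  -- Mean value inequality on the segment from `x` to a nearest boundary point; that segment stays
  -- in the closure. Integrating against the probability `f` gives the constants `D = ∫ d df` and `E
  -- = 1`.
  have hptw : ∀ (φ : 𝓓((⊤ : Opens (RN N)), ℝ)) (a b : ℝ),
      (∀ x ∈ closure (Ω : Set (RN N)), ‖fderiv ℝ φ x‖ ≤ a) →
      (∀ x ∈ frontier (Ω : Set (RN N)), φ x ≤ b) →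
      ∀ x ∈ closure (Ω : Set (RN N)), φ x ≤ d x * a + b := by
    intro φ a b ha hb x hx
    obtain ⟨y, hyf, hy⟩ := isClosed_frontier.exists_infDist_eq_dist hfr x
    have hseg : segment ℝ x y ⊆ closure (Ω : Set (RN N)) := by
      by_cases hxΩ : x ∈ Ω
      · have hdx : d x ≠ 0 := by
          have := (isClosed_frontier.notMem_iff_infDist_pos hfr).1
            fun h : x ∈ frontier (Ω : Set (RN N)) => h.2 (by rwa [Ω.isOpen.interior_eq])
          exact this.ne'
        have h1 : Metric.closedBall x (d x) ⊆ closure (Ω : Set (RN N)) := by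
          rw [← closure_ball x hdx]
          exact closure_mono (ball_infDist_frontier_subset Ω.isOpen hxΩ)
        refine ((convex_closedBall x (d x)).segment_subset
          (Metric.mem_closedBall_self Metric.infDist_nonneg) ?_).trans h1
        rw [Metric.mem_closedBall, dist_comm]
        exact hy.ge
      · have hxf : x ∈ frontier (Ω : Set (RN N)) := by
          rw [Ω.isOpen.frontier_eq]
          exact ⟨hx, hxΩ⟩
        rw [Metric.infDist_zero_of_mem hxf] at hy
        rw [dist_eq_zero.1 hy.symm, segment_same]
        exact Set.singleton_subset_iff.2 (frontier_subset_closure hyf)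
    have hmv := (convex_segment x y).norm_image_sub_le_of_norm_fderiv_le (𝕜 := ℝ) (f := φ) (C := a)
      (fun z _ => φ.contDiff.differentiable (by simp) z) (fun z hz => ha z (hseg hz))
      (right_mem_segment ℝ x y) (left_mem_segment ℝ x y)
    rw [← dist_eq_norm x y, ← hy] at hmv
    have h2 := le_abs_self (φ x - φ y)
    have h3 := hb y hyf
    rw [Real.norm_eq_abs] at hmv
    change _ ≤ a * d x at hmv
    linarith
  obtain ⟨σ, ν, hσ, hσD, hσK, hν, hν1, hνS, h⟩ := exists_vectorMeasure_and_measure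
    (K := closure (Ω : Set (RN N))) (S := frontier (Ω : Set (RN N))) hΩ.isCompact_closure
    (hΩ.isCompact_closure.of_isClosed_subset isClosed_frontier frontier_subset_closure)
    { toFun := fun φ => ∫ x, φ x ∂f
      map_add' := fun φ ψ => integral_add (φ.integrable_of_isFiniteMeasure f)
        (ψ.integrable_of_isFiniteMeasure f)
      map_smul' := fun c φ => integral_const_mul c _ }
    (D := ∫ x, d x ∂f) (E := 1) (integral_nonneg fun _ => Metric.infDist_nonneg) zero_le_one (by
      intro φ a b _ _ ha hb
      change ∫ x, φ x ∂f ≤ _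
      calc ∫ x, φ x ∂f ≤ ∫ x, (d x * a + b) ∂f := by
            refine integral_mono_ae (φ.integrable_of_isFiniteMeasure f)
              ((hdi.mul_const a).add (integrable_const b)) ?_
            filter_upwards [compl_mem_ae_iff.2 hf] with x hx
            exact hptw φ a b ha hb x (by simpa using hx)
        _ = _ := by
            rw [integral_add (hdi.mul_const a) (integrable_const b), integral_mul_const,
              integral_const, probReal_univ, one_smul, one_mul])
  have h' : ∀ φ : 𝓓((⊤ : Opens (RN N)), ℝ), ∫ x, φ x ∂f = gradPairing σ φ + ∫ x, φ x ∂ν := h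
  refine ⟨ν, σ, ⟨?_, hνS⟩, hσ, hσK, hσD, fun φ => by rw [h' φ]; ring⟩
  -- The construction only gives mass at most one. A test function equal to 1 on the closure, with
  -- zero gradient there, makes the `σ` term disappear and equates the masses of `ν` and `f`.
  obtain ⟨φ, hφ1, hφ0⟩ := exists_testFunction_eq_one hΩ.isCompact_closure.isBounded
  have h1 : ∫ x, φ x ∂f = 1 := by
    rw [integral_congr_ae (g := fun _ => (1 : ℝ))]
    · simp
    · filter_upwards [compl_mem_ae_iff.2 hf] with x hx
      exact hφ1 x (by simpa using hx)
  have h2 : ∫ x, φ x ∂ν = ν.real Set.univ := by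
    rw [integral_congr_ae (g := fun _ => (1 : ℝ))]
    · simp
    · filter_upwards [compl_mem_ae_iff.2 hνS] with x hx
      exact hφ1 x (frontier_subset_closure (by simpa using hx))
  have h3 : gradPairing σ φ = 0 := by
    refine VectorMeasure.integral_eq_zero_of_ae ?_
    filter_upwards [compl_mem_ae_iff.2 hσK] with x hx
    exact hφ0 x (by simpa using hx)
  have h4 := h' φ
  rw [h1, h2, h3, zero_add] at h4
  refine ⟨?_⟩
  rw [← ENNReal.ofReal_toReal (measure_ne_top ν Set.univ), ← measureReal_def, ← h4,
    ENNReal.ofReal_one]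

theorem integral_toSignedMeasure_sub {N : ℕ} (f ν : Measure (RN N)) [IsFiniteMeasure f]
    [IsFiniteMeasure ν] (φ : 𝓓((⊤ : Opens (RN N)), ℝ)) :
    ∫ᵛ x, φ x ∂•(f.toSignedMeasure - ν.toSignedMeasure) = ∫ x, φ x ∂f - ∫ x, φ x ∂ν := by
  have hflip : (ContinuousLinearMap.lsmul ℝ ℝ : ℝ →L[ℝ] ℝ →L[ℝ] ℝ) =
      (ContinuousLinearMap.lsmul ℝ ℝ : ℝ →L[ℝ] ℝ →L[ℝ] ℝ).flip := by
    ext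
    simp
  rw [hflip, VectorMeasure.integral_sub_vectorMeasure, VectorMeasure.integral_toSignedMeasure,
    VectorMeasure.integral_toSignedMeasure]
  · simpa [VectorMeasure.Integrable] using φ.integrable_of_isFiniteMeasure f
  · simpa [VectorMeasure.Integrable] using φ.integrable_of_isFiniteMeasure ν

/-! ### The inner minimum for a prescribed boundary measure -/

/-- A function which is `1`-Lipschitz on a ball coincides there, up to a constant, with a compactly
supported `1`-Lipschitz function. -/
theorem exists_lipschitzWith_hasCompactSupport {N : ℕ} {R : ℝ} (hR : 0 ≤ R) {ψ : RN N → ℝ}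
    (hψ : LipschitzOnWith 1 ψ (Metric.closedBall 0 R)) :
    ∃ w : RN N → ℝ, LipschitzWith 1 w ∧ HasCompactSupport w ∧
      ∀ x ∈ Metric.closedBall (0 : RN N) R, w x = ψ x - ψ 0 := by
  obtain ⟨g, hg, hgψ⟩ := hψ.extend_real
  have h0 : (0 : RN N) ∈ Metric.closedBall (0 : RN N) R := Metric.mem_closedBall_self hR
  -- On the ball of radius `R`, `|g x - g 0| ≤ ‖x‖ ≤ R ≤ 2R - ‖x‖`, so truncating at this height
  -- changes nothing there.
  have hcut : LipschitzWith 1 fun x : RN N => max (2 * R - ‖x‖) 0 := by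
    have := ((LipschitzWith.const (2 * R)).sub (lipschitzWith_one_norm (E := RN N))).max_const 0
    simpa using this
  have hgs : LipschitzWith 1 fun x => g x - g 0 := by
    have := hg.sub (LipschitzWith.const (g 0))
    simpa using this
  refine ⟨fun x => max (-max (2 * R - ‖x‖) 0) (min (g x - g 0) (max (2 * R - ‖x‖) 0)), ?_, ?_, ?_⟩
  · simpa using hcut.neg.max (hgs.min hcut)
  · refine HasCompactSupport.intro (isCompact_closedBall (0 : RN N) (2 * R)) fun x hx => ?_
    have hx' : 2 * R < ‖x‖ := by simpa using hx
    rw [max_eq_right (by linarith : 2 * R - ‖x‖ ≤ 0)]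
    simp
  · intro x hx
    have hx' : ‖x‖ ≤ R := by simpa using hx
    have hle := hg.dist_le_mul x 0
    rw [NNReal.coe_one, one_mul, dist_zero_right, Real.dist_eq, abs_le] at hle
    change max (-max (2 * R - ‖x‖) 0) (min (g x - g 0) (max (2 * R - ‖x‖) 0)) = _
    rw [max_eq_left (by linarith : 0 ≤ 2 * R - ‖x‖), min_eq_left (by linarith),
      max_eq_right (by linarith), hgψ hx, hgψ h0]

/-- Existence of a vector measure of least mass with divergence `ν - f`. -/
theorem exists_isLeast_dualValues {N : ℕ} {f ν : Measure (RN N)} [IsProbabilityMeasure f]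
    [IsProbabilityMeasure ν] {K : Set (RN N)} (hK : Bornology.IsBounded K) (hf : f Kᶜ = 0)
    (hν : ν Kᶜ = 0) {Λ : ℝ} (hΛ : 0 ≤ Λ) : ∃ m, IsLeast (dualValues f Λ ν) m := by
  obtain ⟨R, hR, hKR⟩ := hK.subset_ball_lt 0 (0 : RN N)
  have hKR' : K ⊆ Metric.closedBall 0 R := hKR.trans Metric.ball_subset_closedBall
  have hint : ∀ (μ : Measure (RN N)) [IsFiniteMeasure μ] (φ : 𝓓((⊤ : Opens (RN N)), ℝ)),
      Integrable φ μ := fun μ _ φ => φ.integrable_of_isFiniteMeasure μ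
  let L : 𝓓((⊤ : Opens (RN N)), ℝ) →ₗ[ℝ] ℝ :=
    { toFun := fun φ => ∫ x, φ x ∂f - ∫ x, φ x ∂ν
      map_add' := fun φ ψ => by
        change ∫ x, (φ x + ψ x) ∂f - ∫ x, (φ x + ψ x) ∂ν = _
        rw [integral_add (hint f φ) (hint f ψ), integral_add (hint ν φ) (hint ν ψ)]
        ring
      map_smul' := fun c φ => by
        change ∫ x, c * φ x ∂f - ∫ x, c * φ x ∂ν = c * (_ - _)
        rw [integral_const_mul, integral_const_mul, mul_sub] }
  have hL : ∀ φ, L φ = ∫ x, φ x ∂f - ∫ x, φ x ∂ν := fun φ => rfl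
  have hK0 : ∀ (μ : Measure (RN N)) [IsProbabilityMeasure μ], μ Kᶜ = 0 →
      ∀ (φ : 𝓓((⊤ : Opens (RN N)), ℝ)) (w : RN N → ℝ) (c : ℝ), Continuous w →
      HasCompactSupport w → (∀ x ∈ Metric.closedBall (0 : RN N) R, w x = φ x - c) →
      ∫ x, φ x ∂μ = ∫ x, w x ∂μ + c := by
    intro μ _ hμ φ w c hwc hws hw
    have h1 : ∫ x, w x ∂μ = ∫ x, (φ x - c) ∂μ := by
      refine integral_congr_ae ?_
      filter_upwards [compl_mem_ae_iff.2 hμ] with x hx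
      exact hw x (hKR' (by simpa using hx))
    rw [h1, integral_sub (hint μ φ) (integrable_const c), integral_const, probReal_univ, one_smul,
      sub_add_cancel]
  have hlipOn : ∀ φ : 𝓓((⊤ : Opens (RN N)), ℝ),
      (∀ x ∈ Metric.closedBall (0 : RN N) R, ‖fderiv ℝ φ x‖ ≤ 1) →
      LipschitzOnWith 1 φ (Metric.closedBall (0 : RN N) R) := fun φ hφ =>
    (convex_closedBall 0 R).lipschitzOnWith_of_nnnorm_fderiv_le (𝕜 := ℝ)
      (fun z _ => φ.contDiff.differentiable (by simp) z) hφ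
  -- The supremum of `S` is the Kantorovich-Rubinstein distance between `f` and `ν`; it turns out to
  -- be the least mass.
  set S : Set ℝ := {r | ∃ φ : 𝓓((⊤ : Opens (RN N)), ℝ), (∀ x, ‖fderiv ℝ φ x‖ ≤ 1) ∧ r = L φ}
    with hS
  have hS0 : (0 : ℝ) ∈ S := by
    refine ⟨0, fun x => ?_, by simp⟩
    simp [show ((0 : 𝓓((⊤ : Opens (RN N)), ℝ)) : RN N → ℝ) = fun _ => 0 from rfl]
  have hSb : BddAbove S := by
    refine ⟨2 * R, ?_⟩
    rintro _ ⟨φ, hφ, rfl⟩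
    have hbd : ∀ x ∈ K, |φ x - φ 0| ≤ R := by
      intro x hx
      have h1 := (hlipOn φ fun z _ => hφ z).dist_le_mul x (hKR' hx) 0
        (Metric.mem_closedBall_self hR.le)
      rw [NNReal.coe_one, one_mul, Real.dist_eq] at h1
      exact h1.trans (hKR' hx)
    have h1 : ∫ x, φ x ∂f ≤ φ 0 + R := by
      calc ∫ x, φ x ∂f ≤ ∫ _, (φ 0 + R) ∂f := by
            refine integral_mono_ae (hint f φ) (integrable_const _) ?_
            filter_upwards [compl_mem_ae_iff.2 hf] with x hx
            have := (abs_le.1 (hbd x (by simpa using hx))).2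
            linarith
        _ = _ := by simp
    have h2 : φ 0 - R ≤ ∫ x, φ x ∂ν := by
      calc φ 0 - R = ∫ _, (φ 0 - R) ∂ν := by simp
        _ ≤ ∫ x, φ x ∂ν := by
            refine integral_mono_ae (integrable_const _) (hint ν φ) ?_
            filter_upwards [compl_mem_ae_iff.2 hν] with x hx
            have := (abs_le.1 (hbd x (by simpa using hx))).1
            linarith
    rw [hL]
    linarith
  set W := sSup S with hW
  have hW0 : 0 ≤ W := le_csSup hSb hS0
  -- The representation needs a compact set, so the gradient may be controlled only on the ball
  -- carrying `f` and `ν`. The function is replaced outside it; the additive constant cancels as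
  -- both measures have mass one.
  have hlocal : ∀ φ : 𝓓((⊤ : Opens (RN N)), ℝ),
      (∀ x ∈ Metric.closedBall (0 : RN N) R, ‖fderiv ℝ φ x‖ ≤ 1) → L φ ≤ W := by
    intro φ hφ
    obtain ⟨w, hw1, hwc, hw⟩ := exists_lipschitzWith_hasCompactSupport hR.le (hlipOn φ hφ)
    refine le_of_forall_pos_le_add fun ε hε => ?_
    obtain ⟨χ, hχ1, hχ⟩ := exists_testFunction_of_lipschitzWith (Ω := ⊤) hw1 hwc
      (fun _ _ => trivial) (half_pos hε)
    have hχW : L χ ≤ W := le_csSup hSb ⟨χ, hχ1, rfl⟩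
    have hwi : ∀ (μ : Measure (RN N)) [IsFiniteMeasure μ], Integrable w μ := fun μ _ =>
      hw1.continuous.integrable_of_hasCompactSupport hwc
    have hclose : ∀ (μ : Measure (RN N)) [IsProbabilityMeasure μ],
        |∫ x, χ x ∂μ - ∫ x, w x ∂μ| ≤ ε / 2 := by
      intro μ _
      rw [← integral_sub (hint μ χ) (hwi μ), ← Real.norm_eq_abs]
      refine (norm_integral_le_of_norm_le_const (ae_of_all _ hχ)).trans ?_
      simp
    have h1 := (abs_le.1 (hclose f)).1
    have h2 := (abs_le.1 (hclose ν)).2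
    rw [hL] at hχW ⊢
    rw [hK0 f hf φ w _ hw1.continuous hwc hw, hK0 ν hν φ w _ hw1.continuous hwc hw]
    linarith
  have hscale : ∀ (φ : 𝓓((⊤ : Opens (RN N)), ℝ)) (a : ℝ), 0 ≤ a →
      (∀ x ∈ Metric.closedBall (0 : RN N) R, ‖fderiv ℝ φ x‖ ≤ a) → L φ ≤ W * a := by
    intro φ a ha hφ
    -- Dividing by `b > a` and letting `b → a` avoids the case `a = 0`.
    have hpos : ∀ b > a, L φ ≤ W * b := by
      intro b hb
      have hb0 : 0 < b := ha.trans_lt hb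
      have h1 := hlocal (b⁻¹ • φ) fun x hx => by
        have h2 : fderiv ℝ (b⁻¹ • φ : 𝓓((⊤ : Opens (RN N)), ℝ)) x = b⁻¹ • fderiv ℝ φ x :=
          fderiv_const_smul (φ.contDiff.differentiable (by simp) x) b⁻¹
        rw [h2, norm_smul, norm_inv, Real.norm_of_nonneg hb0.le, inv_mul_le_one₀ hb0]
        exact (hφ x hx).trans hb.le
      rw [map_smul, smul_eq_mul, inv_mul_le_iff₀ hb0] at h1
      linarith
    have ht : Tendsto (fun b => W * b) (𝓝[>] a) (𝓝 (W * a)) :=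
      ((continuous_const.mul continuous_id).tendsto a).mono_left nhdsWithin_le_nhds
    exact ge_of_tendsto ht (by filter_upwards [self_mem_nhdsWithin] with b hb using hpos b hb)
  -- With an empty set in place of the boundary, the scalar measure is zero and only the divergence
  -- remains.
  obtain ⟨σ, ν', hσ, hσW, -, -, -, hν', h⟩ := exists_vectorMeasure_and_measure
    (isCompact_closedBall (0 : RN N) R) isCompact_empty L hW0 le_rfl (fun φ a b ha _ hφ _ => by
      rw [zero_mul, add_zero]
      exact hscale φ a ha hφ)
  rw [Set.compl_empty, Measure.measure_univ_eq_zero] at hν'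
  have hdiv : ∀ φ : 𝓓((⊤ : Opens (RN N)), ℝ), gradPairing σ φ =
      ∫ x, φ x ∂f - ∫ x, φ x ∂ν := by
    intro φ
    rw [← hL, h φ, hν', integral_zero_measure, add_zero]
  have hlow : ∀ σ' : VectorMeasure (RN N) (RN N), IsBoundedVectorMeasure σ' →
      (∀ φ : 𝓓((⊤ : Opens (RN N)), ℝ), gradPairing σ' φ = ∫ x, φ x ∂f - ∫ x, φ x ∂ν) →
      W ≤ σ'.variation.real Set.univ := by
    intro σ' hσ' hdiv'
    refine csSup_le ⟨0, hS0⟩ ?_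
    rintro _ ⟨φ, hφ, rfl⟩
    have h1 := abs_gradPairing_le hσ' (φ := φ) (C := 1) fun x => by
      rw [norm_gradient_eq_norm_fderiv]
      exact hφ x
    rw [hL, ← hdiv', ← one_mul (σ'.variation.real Set.univ)]
    exact (le_abs_self _).trans h1
  refine ⟨Λ * W, ⟨σ, hσ, hdiv, ?_⟩, ?_⟩
  · rw [le_antisymm hσW (hlow σ hσ hdiv)]
  · rintro _ ⟨σ', hσ', hdiv', rfl⟩
    exact mul_le_mul_of_nonneg_left (hlow σ' hσ' hdiv') hΛ

/-! ### Assembly of the duality -/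

/-- Duality between the two limit problems for a probability measure on the closure. -/
theorem duality_of_isProbabilityMeasure {N : ℕ} (hN : 0 < N) (Ω : Opens (RN N))
    (hΩ : Bornology.IsBounded (Ω : Set (RN N))) (hne : (Ω : Set (RN N)).Nonempty)
    (f : Measure (RN N)) [IsProbabilityMeasure f] (hf : f (closure (Ω : Set (RN N)))ᶜ = 0)
    {Λ : ℝ} (hΛ : 0 ≤ Λ) :
    ∃ m : ℝ,
      IsLeast (primalValues Ω f Λ) (-m) ∧
      (∀ ν : Measure (RN N), IsBoundaryProbability Ω ν → ∃ mν : ℝ, IsLeast (dualValues f Λ ν) mν) ∧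
      IsLeast (dualMinima Ω f Λ) m ∧
      IsLeast (dualSupportedValues Ω f Λ) m := by
  have hfr := frontier_nonempty_of_isBounded hN hne hΩ
  have hcompl : ((Ω : Set (RN N))ᶜ).Nonempty := by
    obtain ⟨x, hx⟩ := hfr
    rw [Ω.isOpen.frontier_eq] at hx
    exact ⟨x, hx.2⟩
  set d : RN N → ℝ := fun x => Metric.infDist x (frontier (Ω : Set (RN N))) with hd
  have hres : f.restrict (closure (Ω : Set (RN N))) = f :=
    Measure.restrict_eq_self_of_ae_mem (compl_mem_ae_iff.2 hf |> fun h => by simpa using h)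
  have hdi : Integrable d f := integrable_of_continuous_of_measure_compl_closure hΩ hf
    (Metric.continuous_infDist_pt _)
  -- Only the equation inside `Ω` is used, so this one bound serves both forms of the dual problem.
  have hlow : ∀ σ : VectorMeasure (RN N) (RN N), IsBoundedVectorMeasure σ →
      (∀ φ : 𝓓(Ω, ℝ), gradPairing σ φ = ∫ x, φ x ∂f) →
      Λ * ∫ x, d x ∂f ≤ Λ * σ.variation.real Set.univ := fun σ hσ hdiv =>
    mul_le_mul_of_nonneg_left (integral_infDist_le_variation Ω hΩ hcompl hf hσ hdiv) hΛ
  obtain ⟨ν, σ, hν, hσ, hσK, hσD, hdiv⟩ := exists_optimal_boundary Ω hΩ hfr hf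
  have hdivΩ : ∀ φ : 𝓓(Ω, ℝ), gradPairing σ φ = ∫ x, φ x ∂f :=
    gradPairing_eq_of_boundary hν.2 hdiv
  have hσeq : Λ * σ.variation.real Set.univ = Λ * ∫ x, d x ∂f :=
    le_antisymm (mul_le_mul_of_nonneg_left hσD hΛ) (hlow σ hσ hdivΩ)
  have hclosure : ∀ τ : VectorMeasure (RN N) (RN N),
      τ.variation (closure (Ω : Set (RN N)))ᶜ = 0 →
      τ.variation.real (closure (Ω : Set (RN N))) = τ.variation.real Set.univ := by
    intro τ hτ
    have h : closure (Ω : Set (RN N)) =ᵐ[τ.variation] Set.univ :=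
      eventuallyEq_univ.2 (by simpa using compl_mem_ae_iff.2 hτ)
    exact measureReal_congr h
  refine ⟨Λ * ∫ x, d x ∂f, ⟨?_, ?_⟩, ?_, ⟨?_, ?_⟩, ⟨?_, ?_⟩⟩
  · refine ⟨_, isPrimalAdmissible_infDist Ω hΛ, ?_⟩
    rw [hres, integral_const_mul]
  · rintro _ ⟨u, hu, rfl⟩
    rw [hres, ← integral_const_mul, neg_le_neg_iff]
    by_cases hui : Integrable u f
    · refine integral_mono_ae hui (hdi.const_mul Λ) ?_
      filter_upwards [compl_mem_ae_iff.2 hf] with x hx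
      exact (le_abs_self _).trans (hu.abs_le hfr (by simpa using hx))
    -- The default value `0` of the integral is still below `Λ ∫ d df`.
    · rw [integral_undef hui]
      exact integral_nonneg fun x => mul_nonneg hΛ Metric.infDist_nonneg
  · rintro ν' ⟨hν'1, hν'2⟩
    refine exists_isLeast_dualValues hΩ.isCompact_closure.isBounded hf ?_ hΛ
    exact measure_mono_null (Set.compl_subset_compl.2 frontier_subset_closure) hν'2
  · refine ⟨ν, hν, ⟨σ, hσ, hdiv, hσeq.symm⟩, ?_⟩
    rintro _ ⟨σ', hσ', hdiv', rfl⟩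
    exact hlow σ' hσ' (gradPairing_eq_of_boundary hν.2 hdiv')
  · rintro _ ⟨ν', hν', ⟨σ', hσ', hdiv', rfl⟩, -⟩
    exact hlow σ' hσ' (gradPairing_eq_of_boundary hν'.2 hdiv')
  · have := hν.1
    refine ⟨σ, hσ, ?_, ⟨f.toSignedMeasure - ν.toSignedMeasure, fun φ => ?_⟩, hdivΩ, ?_⟩
    · exact Measure.support_subset_of_isClosed isClosed_closure
        (by simpa using compl_mem_ae_iff.2 hσK)
    · rw [hdiv, integral_toSignedMeasure_sub]
    · rw [hclosure σ hσK, hσeq]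
  · rintro _ ⟨σ', hσ', hsupp, -, hdiv', rfl⟩
    rw [hclosure σ' (measure_mono_null (Set.compl_subset_compl.2 hsupp)
      Measure.measure_compl_support)]
    exact hlow σ' hσ' hdiv'

/-! ### Sobolev inequality and higher integrability of eigenfunctions -/

/-- The fundamental theorem of calculus on the line, transported by the isometry `e`. It covers
dimension one, where the exponent `N / (N - 1)` is unavailable. -/
theorem enorm_le_lintegral_fderiv_of_one {v : RN 1 → ℝ} (hv : ContDiff ℝ 1 v)
    (hc : HasCompactSupport v) (x : RN 1) : ‖v x‖ₑ ≤ ∫⁻ y, ‖fderiv ℝ v y‖ₑ := by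
  let e : ℝ → RN 1 := fun t => EuclideanSpace.single 0 t
  have he : ∀ t, e t = t • EuclideanSpace.single (0 : Fin 1) (1 : ℝ) := fun t => by
    ext i
    simp [e, Subsingleton.elim i 0]
  have hmp : MeasurePreserving e := by
    have h1 := (volume_preserving_funUnique (Fin 1) ℝ).symm
    have h2 := (EuclideanSpace.volume_preserving_symm_measurableEquiv_toLp (Fin 1)).symm
    convert! h2.comp h1 using 1
    ext t i
    simp [e, Subsingleton.elim i 0]
  have hd : ∀ t, HasDerivAt e (EuclideanSpace.single (0 : Fin 1) (1 : ℝ)) t := fun t => by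
    have h1 := (hasDerivAt_id' t).smul_const (EuclideanSpace.single (0 : Fin 1) (1 : ℝ))
    rw [one_smul] at h1
    exact h1.congr_of_eventuallyEq (Eventually.of_forall he)
  have hiso : Isometry e := by
    refine Isometry.of_dist_eq fun s t => ?_
    simp [e]
  have hx : e (x 0) = x := by
    ext i
    simp [e, Subsingleton.elim i 0]
  have hsm : ContDiff ℝ 1 e := by
    rw [funext he]
    fun_prop
  have h1 := HasCompactSupport.enorm_le_lintegral_Ici_deriv (hv.comp hsm)
    (hc.comp_isClosedEmbedding hiso.isClosedEmbedding) (x 0)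
  rw [Function.comp_apply, hx] at h1
  have hmeas : Measurable fun y => ‖fderiv ℝ v y‖ₑ := (measurable_fderiv ℝ v).enorm
  rw [← hmp.lintegral_comp hmeas]
  refine h1.trans ((setLIntegral_le_lintegral _ _).trans (lintegral_mono fun t => ?_))
  have h2 : HasDerivAt (v ∘ e) (fderiv ℝ v (e t) (EuclideanSpace.single (0 : Fin 1) (1 : ℝ))) t :=
    ((hv.differentiable one_ne_zero) (e t)).hasFDerivAt.comp_hasDerivAt t (hd t)
  rw [h2.deriv, ← ofReal_norm, ← ofReal_norm]
  refine ENNReal.ofReal_le_ofReal (((fderiv ℝ v (e t)).le_opNorm _).trans ?_)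
  simp

/-- A Sobolev inequality `‖v‖_κ ≤ C ‖∇v‖_1` with some `κ > 1` in every dimension. -/
theorem exists_sobolev_exponent {N : ℕ} (hN : 0 < N) {Ω : Set (RN N)}
    (hΩ : Bornology.IsBounded Ω) :
    ∃ κ : ℝ, 1 < κ ∧ ∃ C : NNReal, ∀ v : RN N → ℝ, ContDiff ℝ 1 v → HasCompactSupport v →
      ∫⁻ x in Ω, ‖v x‖ₑ ^ κ ≤ C * (∫⁻ x, ‖fderiv ℝ v x‖ₑ) ^ κ := by
  rcases Nat.lt_or_ge 1 N with h | h
  · have hN1 : (1 : ℝ) < N := by exact_mod_cast h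
    have hconj := Real.HolderConjugate.conjExponent hN1
    refine ⟨_, hconj.symm.lt,
      lintegralPowLePowLIntegralFDerivConst (volume : Measure (RN N)) (N : ℝ).conjExponent,
      fun v hv hc => (setLIntegral_le_lintegral _ _).trans ?_⟩
    exact lintegral_pow_le_pow_lintegral_fderiv volume hv hc (by simpa using hconj)
  · obtain rfl : N = 1 := by omega
    -- The sup bound on a bounded set would allow any exponent above 1; 2 is a convenient choice.
    refine ⟨2, one_lt_two, (volume Ω).toNNReal, fun v hv hc => ?_⟩
    rw [ENNReal.coe_toNNReal hΩ.measure_lt_top.ne]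
    calc ∫⁻ x in Ω, ‖v x‖ₑ ^ (2 : ℝ)
        ≤ ∫⁻ _ in Ω, (∫⁻ y, ‖fderiv ℝ v y‖ₑ) ^ (2 : ℝ) := by
          refine lintegral_mono fun x => ?_
          exact ENNReal.rpow_le_rpow (enorm_le_lintegral_fderiv_of_one hv hc x) zero_le_two
      _ = _ := by rw [setLIntegral_const, mul_comm]

theorem lintegral_rpow_enorm_eq_eLpNorm_rpow {X E : Type*} [MeasurableSpace X]
    [NormedAddCommGroup E] {μ : Measure X} {p : ℝ} (hp : 0 < p) (f : X → E) :
    ∫⁻ x, ‖f x‖ₑ ^ p ∂μ = eLpNorm f (ENNReal.ofReal p) μ ^ p := by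
  rw [eLpNorm_eq_lintegral_rpow_enorm_toReal (by simpa using hp) ENNReal.ofReal_ne_top,
    ENNReal.toReal_ofReal hp.le, ← ENNReal.rpow_mul, one_div, inv_mul_cancel₀ hp.ne',
    ENNReal.rpow_one]

/-- The product is at most `c` times the `p`-th power of the larger of `a` and `c⁻¹ b`. The weight
`c` will be a bound on the gradient norm, making the two terms comparable uniformly in `p`. -/
theorem rpow_sub_one_mul_le {p a b c : ℝ} (hp : 1 < p) (ha : 0 ≤ a) (hb : 0 ≤ b) (hc : 0 < c) :
    a ^ (p - 1) * b ≤ c * (a ^ p + (c⁻¹ * b) ^ p) := by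
  have hb' : b = c * (c⁻¹ * b) := by field_simp
  have hd : 0 ≤ c⁻¹ * b := by positivity
  set d := c⁻¹ * b
  rw [hb', mul_left_comm]
  refine mul_le_mul_of_nonneg_left ?_ hc.le
  have hsplit : ∀ t : ℝ, 0 ≤ t → t ^ p = t ^ (p - 1) * t := fun t ht => by
    rcases ht.eq_or_lt with rfl | ht
    · rw [Real.zero_rpow (by linarith), mul_zero]
    · rw [Real.rpow_sub_one ht.ne', div_mul_cancel₀ _ ht.ne']
  rcases le_total a d with h | h
  · calc a ^ (p - 1) * d ≤ d ^ (p - 1) * d := by gcongr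
      _ = d ^ p := (hsplit d hd).symm
      _ ≤ _ := le_add_of_nonneg_left (by positivity)
  · calc a ^ (p - 1) * d ≤ a ^ (p - 1) * a := by gcongr
      _ = a ^ p := (hsplit a ha).symm
      _ ≤ _ := le_add_of_nonneg_right (by positivity)

/-- The Sobolev inequality applied to `|φ|^p`. -/
theorem lintegral_rpow_mul_le_of_sobolev {N : ℕ} {Ω : Opens (RN N)} {κ : ℝ} (hκ : 1 < κ)
    {C : NNReal} (hC : ∀ v : RN N → ℝ, ContDiff ℝ 1 v → HasCompactSupport v →
      ∫⁻ x in (Ω : Set (RN N)), ‖v x‖ₑ ^ κ ≤ C * (∫⁻ x, ‖fderiv ℝ v x‖ₑ) ^ κ)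
    {p c : ℝ} (hp : 1 < p) (hc : 0 < c) (φ : 𝓓(Ω, ℝ)) :
    ∫⁻ x in (Ω : Set (RN N)), ‖φ x‖ₑ ^ (p * κ) ≤
      C * (ENNReal.ofReal (p * c) *
        (eLpNorm φ (ENNReal.ofReal p) (volume.restrict (Ω : Set (RN N))) ^ p +
        (ENNReal.ofReal c⁻¹ * eLpNorm (∇ (φ : RN N → ℝ)) (ENNReal.ofReal p)
          (volume.restrict (Ω : Set (RN N)))) ^ p)) ^ κ := by
  have hp0 : 0 < p := by linarith
  have hφ1 : ContDiff ℝ 1 φ := φ.contDiff.of_le (by exact_mod_cast le_top)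
  have hv : ContDiff ℝ 1 fun x => ‖φ x‖ ^ p := hφ1.norm_rpow hp
  have hvc : HasCompactSupport fun x => ‖φ x‖ ^ p :=
    φ.hasCompactSupport.comp_left (g := fun t : ℝ => ‖t‖ ^ p) (by simp [hp0.ne'])
  have h1 := hC _ hv hvc
  have hpow : ∀ x, ‖‖φ x‖ ^ p‖ₑ ^ κ = ‖φ x‖ₑ ^ (p * κ) := fun x => by
    rw [ENNReal.rpow_mul, Real.enorm_rpow_of_nonneg (norm_nonneg _) hp0.le, enorm_norm]
  simp_rw [hpow] at h1
  refine h1.trans ?_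
  gcongr
  have hpt : ∀ x, ‖fderiv ℝ (fun x => ‖φ x‖ ^ p) x‖ₑ ≤ (Ω : Set (RN N)).indicator (fun x =>
      ENNReal.ofReal (p * c) * (‖φ x‖ₑ ^ p +
        (ENNReal.ofReal c⁻¹ * ‖∇ (φ : RN N → ℝ) x‖ₑ) ^ p)) x := by
    intro x
    by_cases hx : x ∈ (Ω : Set (RN N))
    · rw [Set.indicator_of_mem hx]
      have h2 := norm_fderiv_norm_rpow_le (hφ1.differentiable one_ne_zero) (x := x) hp
      have h3 := rpow_sub_one_mul_le hp (norm_nonneg (φ x)) (norm_nonneg (fderiv ℝ φ x)) hc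
      have h4 : ‖fderiv ℝ (fun x => ‖φ x‖ ^ p) x‖ ≤
          p * c * (‖φ x‖ ^ p + (c⁻¹ * ‖∇ (φ : RN N → ℝ) x‖) ^ p) := by
        rw [norm_gradient_eq_norm_fderiv]
        calc _ ≤ _ := h2
          _ = p * (‖φ x‖ ^ (p - 1) * ‖fderiv ℝ φ x‖) := by ring
          _ ≤ p * (c * (‖φ x‖ ^ p + (c⁻¹ * ‖fderiv ℝ φ x‖) ^ p)) := by gcongr
          _ = _ := by ring
      rw [← ofReal_norm]
      refine (ENNReal.ofReal_le_ofReal h4).trans_eq ?_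
      rw [ENNReal.ofReal_mul (p := p * c) (by positivity), ENNReal.ofReal_add (by positivity) (by positivity),
        ← ENNReal.ofReal_rpow_of_nonneg (norm_nonneg _) hp0.le,
        ← ENNReal.ofReal_rpow_of_nonneg (by positivity) hp0.le,
        ENNReal.ofReal_mul (inv_pos.2 hc).le (q := ‖∇ (φ : RN N → ℝ) x‖), ofReal_norm, ofReal_norm]
    · have hxt : x ∉ tsupport (fun x => ‖φ x‖ ^ p) := fun h => hx
        (φ.tsupport_subset (tsupport_comp_subset (g := fun t : ℝ => ‖t‖ ^ p)
          (by simp [hp0.ne']) φ h))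
      have : fderiv ℝ (fun x => ‖φ x‖ ^ p) x = 0 :=
        image_eq_zero_of_notMem_tsupport fun h => hxt (tsupport_fderiv_subset ℝ h)
      rw [this]
      exact (enorm_zero (E := RN N →L[ℝ] ℝ)).le.trans zero_le
  refine (lintegral_mono hpt).trans_eq ?_
  have hm1 : Measurable fun x => ‖φ x‖ₑ ^ p := (φ.continuous.measurable.enorm).pow_const p
  rw [lintegral_indicator Ω.isOpen.measurableSet, lintegral_const_mul' _ _ ENNReal.ofReal_ne_top,
    lintegral_add_left hm1, lintegral_rpow_enorm_eq_eLpNorm_rpow hp0]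
  simp_rw [ENNReal.mul_rpow_of_nonneg _ _ hp0.le]
  rw [lintegral_const_mul' _ _ (by finiteness), lintegral_rpow_enorm_eq_eLpNorm_rpow hp0]

/-- Higher integrability for limits of test functions. -/
theorem MemW01p.lintegral_rpow_mul_le {N : ℕ} {Ω : Opens (RN N)} {κ : ℝ} (hκ : 1 < κ)
    {C : NNReal} (hC : ∀ v : RN N → ℝ, ContDiff ℝ 1 v → HasCompactSupport v →
      ∫⁻ x in (Ω : Set (RN N)), ‖v x‖ₑ ^ κ ≤ C * (∫⁻ x, ‖fderiv ℝ v x‖ₑ) ^ κ)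
    {p c : ℝ} (hp : 1 < p) (hc : 0 < c) {u : RN N → ℝ} {G : RN N → RN N} (hu : MemW01p p Ω u G)
    (hu1 : eLpNorm u (ENNReal.ofReal p) (volume.restrict (Ω : Set (RN N))) ≤ 1)
    (hG : eLpNorm G (ENNReal.ofReal p) (volume.restrict (Ω : Set (RN N))) ≤ ENNReal.ofReal c) :
    ∫⁻ x in (Ω : Set (RN N)), ‖u x‖ₑ ^ (p * κ) ≤ C * (ENNReal.ofReal (p * c) * 2) ^ κ := by
  have hp0 : 0 < p := by linarith
  have hκ0 : 0 < κ := by linarith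
  have hp1 : 1 ≤ ENNReal.ofReal p := by simpa using hp.le
  obtain ⟨φ, h1, h2⟩ := hu.approx
  set μ := (volume : Measure (RN N)).restrict (Ω : Set (RN N))
  -- Convergence in `L^p` gives an almost everywhere convergent subsequence, and Fatou's lemma
  -- carries the bound to `u`.
  have hin : TendstoInMeasure μ (fun k => (φ k : RN N → ℝ)) atTop u :=
    tendstoInMeasure_of_tendsto_eLpNorm (by simpa using hp0)
      (fun k => (φ k).continuous.aestronglyMeasurable) hu.memLp.1 h1
  obtain ⟨ns, hns, hae⟩ := hin.exists_seq_tendsto_ae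
  set a : ℕ → ENNReal := fun k => eLpNorm (fun x => φ k x - u x) (ENNReal.ofReal p) μ
  set b : ℕ → ENNReal := fun k =>
    eLpNorm (fun x => ∇ (φ k : RN N → ℝ) x - G x) (ENNReal.ofReal p) μ
  have hbound : ∀ k, ∫⁻ x, ‖φ k x‖ₑ ^ (p * κ) ∂μ ≤ C * (ENNReal.ofReal (p * c) *
      ((a k + 1) ^ p + (ENNReal.ofReal c⁻¹ * (b k + ENNReal.ofReal c)) ^ p)) ^ κ := by
    intro k
    refine (lintegral_rpow_mul_le_of_sobolev hκ hC hp hc (φ k)).trans ?_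
    have h3 : eLpNorm (φ k) (ENNReal.ofReal p) μ ≤ a k + 1 := by
      have : (φ k : RN N → ℝ) = (fun x => φ k x - u x) + u := by ext x; simp
      rw [this]
      exact (eLpNorm_add_le ((φ k).continuous.aestronglyMeasurable.sub hu.memLp.1)
        hu.memLp.1 hp1).trans (add_le_add le_rfl hu1)
    have h4 : eLpNorm (∇ (φ k : RN N → ℝ)) (ENNReal.ofReal p) μ ≤ b k + ENNReal.ofReal c := by
      have : (∇ (φ k : RN N → ℝ)) = (fun x => ∇ (φ k : RN N → ℝ) x - G x) + G := by ext x; simp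
      rw [this]
      exact (eLpNorm_add_le ((φ k).continuous_gradient.aestronglyMeasurable.sub hu.memLp_grad.1)
        hu.memLp_grad.1 hp1).trans (add_le_add le_rfl hG)
    gcongr
  have hlim : Tendsto (fun k => C * (ENNReal.ofReal (p * c) *
      ((a k + 1) ^ p + (ENNReal.ofReal c⁻¹ * (b k + ENNReal.ofReal c)) ^ p)) ^ κ) atTop
      (𝓝 (C * (ENNReal.ofReal (p * c) *
      ((0 + 1) ^ p + (ENNReal.ofReal c⁻¹ * (0 + ENNReal.ofReal c)) ^ p)) ^ κ)) := by
    refine ENNReal.Tendsto.const_mul (Tendsto.ennrpow_const κ (ENNReal.Tendsto.const_mul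
      (((h1.add_const 1).ennrpow_const p).add ((ENNReal.Tendsto.const_mul (h2.add_const _)
        (Or.inr ENNReal.ofReal_ne_top)).ennrpow_const p)) (Or.inr ENNReal.ofReal_ne_top)))
      (Or.inr ENNReal.coe_ne_top)
  have hval : (0 + 1 : ENNReal) ^ p + (ENNReal.ofReal c⁻¹ * (0 + ENNReal.ofReal c)) ^ p = 2 := by
    rw [zero_add, zero_add, ← ENNReal.ofReal_mul (by positivity), inv_mul_cancel₀ hc.ne',
      ENNReal.ofReal_one, ENNReal.one_rpow, one_add_one_eq_two]
  rw [hval] at hlim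
  calc ∫⁻ x, ‖u x‖ₑ ^ (p * κ) ∂μ
      = ∫⁻ x, liminf (fun k => ‖φ (ns k) x‖ₑ ^ (p * κ)) atTop ∂μ := by
        refine lintegral_congr_ae ?_
        filter_upwards [hae] with x hx
        exact (hx.enorm.ennrpow_const (p * κ)).liminf_eq.symm
    _ ≤ liminf (fun k => ∫⁻ x, ‖φ (ns k) x‖ₑ ^ (p * κ) ∂μ) atTop :=
        lintegral_liminf_le fun k => ((φ (ns k)).continuous.measurable.enorm).pow_const _
    _ ≤ liminf (fun k => C * (ENNReal.ofReal (p * c) * ((a (ns k) + 1) ^ p +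
          (ENNReal.ofReal c⁻¹ * (b (ns k) + ENNReal.ofReal c)) ^ p)) ^ κ) atTop :=
        liminf_le_liminf (Eventually.of_forall fun k => hbound (ns k))
    _ = _ := (hlim.comp hns.tendsto_atTop).liminf_eq

/-- Passing to the limit in the pairing of `‖g‖^{p-2} g` with an `L^p`-convergent sequence. -/
theorem tendsto_integral_rpow_mul_inner {X E : Type*} [MeasurableSpace X] {μ : Measure X}
    [NormedAddCommGroup E] [InnerProductSpace ℝ E] {p : ℝ} (hp : 1 < p) {g : X → E}
    (hg : MemLp g (ENNReal.ofReal p) μ) {h : ℕ → X → E}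
    (hm : ∀ k, AEStronglyMeasurable (h k) μ)
    (hh : Tendsto (fun k => eLpNorm (fun x => h k x - g x) (ENNReal.ofReal p) μ) atTop (𝓝 0)) :
    Tendsto (fun k => ∫ x, ‖g x‖ ^ (p - 2) * ⟪g x, h k x⟫ ∂μ) atTop (𝓝 (∫ x, ‖g x‖ ^ p ∂μ)) := by
  have hconj := Real.HolderConjugate.conjExponent hp
  set q := p.conjExponent with hq
  have hq0 : 0 < q := hconj.symm.pos
  have hqp : q * (p - 1) = p := by
    rw [hq, Real.conjExponent, div_mul_cancel₀ _ (by linarith)]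
  have := hconj.symm.ennrealOfReal
  -- The field `‖g‖^{p-2} g` lies in the conjugate space `L^q`, so Hölder's inequality gives
  -- convergence of the pairing.
  let w : X → E := fun x => ‖g x‖ ^ (p - 2) • g x
  have hwm : AEStronglyMeasurable w μ :=
    (hg.1.norm.aemeasurable.pow_const (p - 2)).aestronglyMeasurable.smul hg.1
  have hwn : ∀ x, ‖w x‖ = ‖g x‖ ^ (p - 1) := fun x => by
    rw [norm_smul, Real.norm_of_nonneg (by positivity)]
    rcases (norm_nonneg (g x)).eq_or_lt with h0 | h0
    · rw [← h0, Real.zero_rpow (by linarith : p - 1 ≠ 0), mul_zero]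
    · rw [← Real.rpow_add_one h0.ne']
      ring_nf
  have hw : eLpNorm w (ENNReal.ofReal q) μ ≠ ⊤ := by
    have h1 : eLpNorm w (ENNReal.ofReal q) μ =
        eLpNorm (fun x => ‖g x‖ ^ (p - 1)) (ENNReal.ofReal q) μ :=
      eLpNorm_congr_norm_ae (ae_of_all _ fun x => by
        rw [hwn, Real.norm_of_nonneg (by positivity)])
    rw [h1, eLpNorm_norm_rpow _ (by linarith : 0 < p - 1), ← ENNReal.ofReal_mul hq0.le, hqp]
    exact ENNReal.rpow_ne_top_of_nonneg (by linarith) hg.2.ne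
  have hF : ∀ (v : X → E) x, ‖g x‖ ^ (p - 2) * ⟪g x, v x⟫ = ⟪w x, v x⟫ := fun v x => by
    rw [real_inner_smul_left]
  have hself : ∀ x, ⟪w x, g x⟫ = ‖g x‖ ^ p := fun x => by
    rw [real_inner_smul_left, real_inner_self_eq_norm_sq]
    rcases (norm_nonneg (g x)).eq_or_lt with h0 | h0
    · rw [← h0, Real.zero_rpow (by linarith : p ≠ 0)]
      simp
    · rw [← Real.rpow_natCast, ← Real.rpow_add h0]
      norm_num
  have hle : ∀ v : X → E, AEStronglyMeasurable v μ → eLpNorm (fun x => ⟪w x, v x⟫) 1 μ ≤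
      eLpNorm w (ENNReal.ofReal q) μ * eLpNorm v (ENNReal.ofReal p) μ := by
    intro v hv
    have := eLpNorm_le_eLpNorm_mul_eLpNorm_of_nnnorm (p := ENNReal.ofReal q)
      (q := ENNReal.ofReal p) (r := 1) hwm hv (fun a b => ⟪a, b⟫) 1 (ae_of_all _ fun x => by
        rw [one_mul]
        exact nnnorm_inner_le_nnnorm _ _)
    simpa using this
  simp_rw [hF, ← hself]
  refine tendsto_integral_of_L1' _ (hwm.inner hg.1) ?_ ?_
  · have hev : ∀ᶠ k in atTop, eLpNorm (fun x => h k x - g x) (ENNReal.ofReal p) μ < ⊤ :=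
      hh.eventually (gt_mem_nhds ENNReal.zero_lt_top)
    filter_upwards [hev] with k hk
    have hmem : MemLp (h k) (ENNReal.ofReal p) μ := by
      have h2 : MemLp (fun x => h k x - g x) (ENNReal.ofReal p) μ := ⟨(hm k).sub hg.1, hk⟩
      have h3 : (fun x => h k x - g x) + g = h k := by
        ext x
        simp
      exact h3 ▸ h2.add hg
    rw [← memLp_one_iff_integrable]
    exact ⟨hwm.inner (hm k), (hle _ (hm k)).trans_lt
      (ENNReal.mul_lt_top hw.lt_top hmem.2)⟩
  · have hz : Tendsto (fun k => eLpNorm w (ENNReal.ofReal q) μ *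
        eLpNorm (fun x => h k x - g x) (ENNReal.ofReal p) μ) atTop (𝓝 0) := by
      simpa using ENNReal.Tendsto.const_mul hh (Or.inr hw)
    refine tendsto_of_tendsto_of_tendsto_of_le_of_le tendsto_const_nhds hz (fun _ => zero_le)
      fun k => ?_
    have h3 : (fun x => ⟪w x, h k x⟫) - (fun x => ⟪w x, g x⟫) =
        fun x => ⟪w x, h k x - g x⟫ := by
      ext x
      simp [inner_sub_right]
    change eLpNorm ((fun x => ⟪w x, h k x⟫) - fun x => ⟪w x, g x⟫) 1 μ ≤ _
    rw [h3]
    exact hle _ ((hm k).sub hg.1)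

/-- The eigenvalue equation tested with the eigenfunction itself. -/
theorem IsPLaplaceSolution.integral_norm_rpow_eq {N : ℕ} {Ω : Opens (RN N)} {p lam : ℝ}
    (hp : 1 < p) {u : RN N → ℝ} {G : RN N → RN N} (hu : MemW01p p Ω u G)
    (heq : ∀ φ : 𝓓(Ω, ℝ),
      ∫ x in (Ω : Set (RN N)), ‖G x‖ ^ (p - 2) * ⟪G x, ∇ (φ : RN N → ℝ) x⟫ =
        lam * ∫ x in (Ω : Set (RN N)), |u x| ^ (p - 2) * u x * φ x) :
    ∫ x in (Ω : Set (RN N)), ‖G x‖ ^ p = lam * ∫ x in (Ω : Set (RN N)), |u x| ^ p := by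
  obtain ⟨φ, h1, h2⟩ := hu.approx
  have hA := tendsto_integral_rpow_mul_inner hp hu.memLp_grad
    (fun k => (φ k).continuous_gradient.aestronglyMeasurable) h2
  have hB := (tendsto_integral_rpow_mul_inner hp hu.memLp
    (fun k => (φ k).continuous.aestronglyMeasurable) h1).const_mul lam
  refine tendsto_nhds_unique hA (hB.congr fun k => ?_)
  rw [heq]
  congr 1
  refine integral_congr_ae (ae_of_all _ fun x => ?_)
  simp only [Real.norm_eq_abs, real_inner_eq_re_inner, RCLike.re_to_real]
  rw [show (inner ℝ (u x) (φ k x) : ℝ) = φ k x * u x from rfl]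
  ring

theorem IsFirstEigenpair.integral_abs_rpow {N : ℕ} {Ω : Opens (RN N)} {p lam : ℝ}
    {u : RN N → ℝ} (h : IsFirstEigenpair p Ω lam u) :
    ∫ x in (Ω : Set (RN N)), |u x| ^ p = 1 := by
  rw [← h.normalized]
  refine integral_congr_ae ?_
  filter_upwards [h.pos] with x hx
  rw [abs_of_pos hx]

/-- Testing the equation with `u` gives `‖∇u‖_p = lam^{1/p} ≤ c`. The resulting bound grows only
like a power of `p`. -/
theorem IsFirstEigenpair.lintegral_rpow_mul_le {N : ℕ} {Ω : Opens (RN N)} {κ : ℝ} (hκ : 1 < κ)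
    {C : NNReal} (hC : ∀ v : RN N → ℝ, ContDiff ℝ 1 v → HasCompactSupport v →
      ∫⁻ x in (Ω : Set (RN N)), ‖v x‖ₑ ^ κ ≤ C * (∫⁻ x, ‖fderiv ℝ v x‖ₑ) ^ κ)
    {p lam c : ℝ} (hp : 1 < p) (hc : 0 < c) {u : RN N → ℝ} (h : IsFirstEigenpair p Ω lam u)
    (hlam : lam ^ (1 / p) ≤ c) :
    ∫⁻ x in (Ω : Set (RN N)), ‖u x‖ₑ ^ (p * κ) ≤ C * (ENNReal.ofReal (p * c) * 2) ^ κ := by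
  obtain ⟨G, hu, heq⟩ := h.isSolution
  have hp0 : 0 < p := by linarith
  have hG := IsPLaplaceSolution.integral_norm_rpow_eq hp hu heq
  rw [h.integral_abs_rpow, mul_one] at hG
  refine hu.lintegral_rpow_mul_le hκ hC hp hc ?_ ?_
  · rw [hu.memLp.eLpNorm_eq_integral_rpow_norm (by simpa using hp0) ENNReal.ofReal_ne_top,
      ENNReal.toReal_ofReal hp0.le]
    simp [Real.norm_eq_abs, h.integral_abs_rpow]
  · rw [hu.memLp_grad.eLpNorm_eq_integral_rpow_norm (by simpa using hp0) ENNReal.ofReal_ne_top,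
      ENNReal.toReal_ofReal hp0.le, hG, ← one_div]
    exact ENNReal.ofReal_le_ofReal hlam

/-! ### The limit measure has mass one -/

theorem IsFirstEigenpair.integrable_rpow {N : ℕ} {Ω : Opens (RN N)} {p lam : ℝ}
    {u : RN N → ℝ} (h : IsFirstEigenpair p Ω lam u) :
    Integrable (fun x => u x ^ p) (volume.restrict (Ω : Set (RN N))) :=
  Integrable.of_integral_ne_zero (by rw [h.normalized]; exact one_ne_zero)

theorem IsFirstEigenpair.aestronglyMeasurable {N : ℕ} {Ω : Opens (RN N)} {p lam : ℝ}
    {u : RN N → ℝ} (h : IsFirstEigenpair p Ω lam u) :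
    AEStronglyMeasurable u (volume.restrict (Ω : Set (RN N))) := by
  obtain ⟨G, hu, -⟩ := h.isSolution
  exact hu.memLp.1

/-- Weighted arithmetic-geometric mean of `t^p` and `1`, with weights `(p-1)/p` and `1/p`. These
tend to 1 and 0, so the mass bound is sharp in the limit. -/
theorem rpow_sub_one_le {p t : ℝ} (hp : 1 < p) (ht : 0 ≤ t) :
    t ^ (p - 1) ≤ (p - 1) / p * t ^ p + 1 / p := by
  have hp0 : 0 < p := by linarith
  have := Real.geom_mean_le_arith_mean2_weighted (w₁ := (p - 1) / p) (w₂ := 1 / p)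
    (p₁ := t ^ p) (p₂ := 1) (div_nonneg (by linarith) hp0.le) (by positivity)
    (Real.rpow_nonneg ht p) zero_le_one (by field_simp; ring)
  rwa [Real.one_rpow, mul_one, mul_one, ← Real.rpow_mul ht, mul_div_cancel₀ _ hp0.ne'] at this

theorem IsFirstEigenpair.integrable_rpow_sub_one {N : ℕ} {Ω : Opens (RN N)}
    (hΩ : Bornology.IsBounded (Ω : Set (RN N))) {p lam : ℝ} (hp : 1 < p)
    {u : RN N → ℝ} (h : IsFirstEigenpair p Ω lam u) :
    Integrable (fun x => u x ^ (p - 1)) (volume.restrict (Ω : Set (RN N))) := by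
  have hfin : IsFiniteMeasure (volume.restrict (Ω : Set (RN N))) := ⟨by
    rw [Measure.restrict_apply_univ]
    exact hΩ.measure_lt_top⟩
  refine Integrable.mono' ((h.integrable_rpow.const_mul ((p - 1) / p)).add
    (integrable_const (1 / p))) (h.aestronglyMeasurable.aemeasurable.pow_const _).aestronglyMeasurable
    ?_
  filter_upwards [h.pos] with x hx
  rw [Real.norm_of_nonneg (Real.rpow_nonneg hx.le _)]
  exact rpow_sub_one_le hp hx.le

theorem IsFirstEigenpair.integral_rpow_sub_one_le {N : ℕ} {Ω : Opens (RN N)}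
    (hΩ : Bornology.IsBounded (Ω : Set (RN N))) {p lam : ℝ} (hp : 1 < p)
    {u : RN N → ℝ} (h : IsFirstEigenpair p Ω lam u) :
    ∫ x in (Ω : Set (RN N)), u x ^ (p - 1) ≤ 1 + volume.real (Ω : Set (RN N)) / p := by
  have hfin : IsFiniteMeasure (volume.restrict (Ω : Set (RN N))) := ⟨by
    rw [Measure.restrict_apply_univ]
    exact hΩ.measure_lt_top⟩
  have hp0 : 0 < p := by linarith
  calc ∫ x in (Ω : Set (RN N)), u x ^ (p - 1)
      ≤ ∫ x in (Ω : Set (RN N)), ((p - 1) / p * u x ^ p + 1 / p) := by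
        refine integral_mono_ae (h.integrable_rpow_sub_one hΩ hp)
          ((h.integrable_rpow.const_mul _).add (integrable_const _)) ?_
        filter_upwards [h.pos] with x hx
        exact rpow_sub_one_le hp hx.le
    _ = (p - 1) / p + volume.real (Ω : Set (RN N)) / p := by
        rw [integral_add (h.integrable_rpow.const_mul _) (integrable_const _), integral_const_mul,
          h.normalized, mul_one, integral_const, measureReal_restrict_apply MeasurableSet.univ,
          Set.univ_inter, smul_eq_mul, mul_one_div]
    _ ≤ _ := by
        have : (p - 1) / p ≤ 1 := (div_le_one hp0).2 (by linarith)
        linarith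

/-- For `t ≤ M` one factor `t` is bounded by `M`; for `t ≥ M` the factor `(t / M)^{p(κ-1)}` is at
least 1. -/
theorem rpow_le_mul_rpow_sub_one_add {p κ M t : ℝ} (hκ : 1 < κ) (hp : 1 < p) (hM : 1 < M)
    (ht : 0 < t) : t ^ p ≤ M * t ^ (p - 1) + M ^ (-(p * (κ - 1))) * t ^ (p * κ) := by
  have hM0 : 0 < M := by linarith
  rcases le_total t M with h | h
  · have h1 : t ^ p = t * t ^ (p - 1) := by
      rw [Real.rpow_sub_one ht.ne', mul_div_cancel₀ _ ht.ne']
    rw [h1]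
    have h2 : t * t ^ (p - 1) ≤ M * t ^ (p - 1) := by gcongr
    have h3 : 0 ≤ M ^ (-(p * (κ - 1))) * t ^ (p * κ) := by positivity
    linarith
  · have h1 : t ^ (p * κ) = t ^ p * t ^ (p * (κ - 1)) := by
      rw [← Real.rpow_add ht]
      ring_nf
    have h2 : M ^ (p * (κ - 1)) ≤ t ^ (p * (κ - 1)) :=
      Real.rpow_le_rpow hM0.le h (mul_nonneg (by linarith) (by linarith))
    have h3 : 0 < M ^ (p * (κ - 1)) := by positivity
    have h4 : t ^ p ≤ M ^ (-(p * (κ - 1))) * t ^ (p * κ) := by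
      rw [Real.rpow_neg hM0.le, h1, mul_left_comm]
      refine le_mul_of_one_le_right (by positivity) ?_
      rw [inv_mul_eq_div]
      exact (one_le_div h3).2 h2
    have h5 : 0 ≤ M * t ^ (p - 1) := by positivity
    linarith

theorem IsFirstEigenpair.one_le_integral_rpow_sub_one {N : ℕ} {Ω : Opens (RN N)}
    (hΩ : Bornology.IsBounded (Ω : Set (RN N))) {κ : ℝ} (hκ : 1 < κ)
    {C : NNReal} (hC : ∀ v : RN N → ℝ, ContDiff ℝ 1 v → HasCompactSupport v →
      ∫⁻ x in (Ω : Set (RN N)), ‖v x‖ₑ ^ κ ≤ C * (∫⁻ x, ‖fderiv ℝ v x‖ₑ) ^ κ)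
    {p lam c M : ℝ} (hp : 1 < p) (hc : 0 < c) (hM : 1 < M) {u : RN N → ℝ}
    (h : IsFirstEigenpair p Ω lam u) (hlam : lam ^ (1 / p) ≤ c) :
    1 ≤ M * (∫ x in (Ω : Set (RN N)), u x ^ (p - 1)) +
      M ^ (-(p * (κ - 1))) * (C * (p * c * 2) ^ κ) := by
  have hp0 : 0 < p := by linarith
  have hκ0 : 0 < κ := by linarith
  have hbound := h.lintegral_rpow_mul_le hκ hC hp hc hlam
  have hm : AEStronglyMeasurable (fun x => u x ^ (p * κ))
      (volume.restrict (Ω : Set (RN N))) :=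
    (h.aestronglyMeasurable.aemeasurable.pow_const _).aestronglyMeasurable
  have hlin : ∫⁻ x in (Ω : Set (RN N)), ENNReal.ofReal (u x ^ (p * κ)) ≤
      ENNReal.ofReal (C * (p * c * 2) ^ κ) := by
    calc ∫⁻ x in (Ω : Set (RN N)), ENNReal.ofReal (u x ^ (p * κ))
        = ∫⁻ x in (Ω : Set (RN N)), ‖u x‖ₑ ^ (p * κ) := by
          refine lintegral_congr_ae ?_
          filter_upwards [h.pos] with x hx
          rw [Real.enorm_eq_ofReal hx.le, ENNReal.ofReal_rpow_of_pos hx]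
      _ ≤ _ := hbound
      _ = _ := by
          rw [ENNReal.ofReal_mul (p := (C : ℝ)) C.coe_nonneg, ← ENNReal.ofReal_rpow_of_nonneg (by positivity) hκ0.le,
            ENNReal.ofReal_mul (p := p * c) (by positivity)]
          simp
  have hpos : 0 ≤ᵐ[volume.restrict (Ω : Set (RN N))] fun x => u x ^ (p * κ) := by
    filter_upwards [h.pos] with x hx
    exact Real.rpow_nonneg hx.le _
  have hint : Integrable (fun x => u x ^ (p * κ)) (volume.restrict (Ω : Set (RN N))) :=
    (lintegral_ofReal_ne_top_iff_integrable hm hpos).1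
      (hlin.trans_lt ENNReal.ofReal_lt_top).ne
  have hle : ∫ x in (Ω : Set (RN N)), u x ^ (p * κ) ≤ C * (p * c * 2) ^ κ := by
    rw [integral_eq_lintegral_of_nonneg_ae hpos hm]
    exact ENNReal.toReal_le_of_le_ofReal (by positivity) hlin
  have hI := h.integrable_rpow_sub_one hΩ hp
  calc (1 : ℝ) = ∫ x in (Ω : Set (RN N)), u x ^ p := h.normalized.symm
    _ ≤ ∫ x in (Ω : Set (RN N)), (M * u x ^ (p - 1) + M ^ (-(p * (κ - 1))) * u x ^ (p * κ)) := by
        refine integral_mono_ae h.integrable_rpow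
          ((hI.const_mul M).add (hint.const_mul _)) ?_
        filter_upwards [h.pos] with x hx
        exact rpow_le_mul_rpow_sub_one_add hκ hp hM hx
    _ = M * (∫ x in (Ω : Set (RN N)), u x ^ (p - 1)) +
          M ^ (-(p * (κ - 1))) * ∫ x in (Ω : Set (RN N)), u x ^ (p * κ) := by
        rw [integral_add (hI.const_mul M) (hint.const_mul _), integral_const_mul,
          integral_const_mul]
    _ ≤ _ := by gcongr

/-- Exponential decay in `p`, from `M > 1`, beats the power `p^κ` of the Sobolev bound. -/
theorem tendsto_rpow_neg_mul_rpow {κ M : ℝ} (hκ : 1 < κ) (hM : 1 < M) {c : ℝ} (hc : 0 < c)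
    (C : ℝ) : Tendsto (fun p : ℝ => M ^ (-(p * (κ - 1))) * (C * (p * c * 2) ^ κ)) atTop (𝓝 0) := by
  have hb : 0 < (κ - 1) * Real.log M := mul_pos (by linarith) (Real.log_pos hM)
  have h := (tendsto_rpow_mul_exp_neg_mul_atTop_nhds_zero κ _ hb).const_mul (C * (c * 2) ^ κ)
  rw [mul_zero] at h
  refine h.congr' ?_
  filter_upwards [eventually_gt_atTop 0] with p hp
  rw [mul_assoc p c 2, Real.mul_rpow hp.le (by positivity), Real.rpow_def_of_pos (by linarith : 0 < M)]
  ring_nf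

theorem IsLimitAsPToInfty.isProbabilityMeasure {N : ℕ} (hN : 0 < N) {Ω : Opens (RN N)}
    (hΩ : Bornology.IsBounded (Ω : Set (RN N))) {f : Measure (RN N)} {Λ : ℝ}
    (hlim : IsLimitAsPToInfty Ω f Λ) : IsProbabilityMeasure f := by
  obtain ⟨hfin, -, p, lam, u, -, hp, hpair, hlam, hconv⟩ := hlim
  obtain ⟨κ, hκ, C, hC⟩ := exists_sobolev_exponent hN hΩ
  have hI := hconv (BoundedContinuousFunction.const _ 1)
  simp only [BoundedContinuousFunction.const_apply, one_mul, integral_const, smul_eq_mul,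
    mul_one] at hI
  have hc : 0 < |Λ| + 1 := by positivity
  have hlt : ∀ᶠ n in atTop, lam n ^ (1 / p n) ≤ |Λ| + 1 :=
    (hlam.eventually (gt_mem_nhds (by linarith [le_abs_self Λ]))).mono fun n hn => le_of_lt hn
  have hp1 : ∀ᶠ n in atTop, 1 < p n := hp.eventually_gt_atTop 1
  have hupper : f.real Set.univ ≤ 1 := by
    have h1 : Tendsto (fun n => 1 + volume.real (Ω : Set (RN N)) / p n) atTop (𝓝 (1 + 0)) :=
      tendsto_const_nhds.add (tendsto_const_nhds.div_atTop hp)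
    rw [add_zero] at h1
    refine le_of_tendsto_of_tendsto hI h1 ?_
    filter_upwards [hp1] with n hn
    exact (hpair n).integral_rpow_sub_one_le hΩ hn
  -- The order of limits matters: `p → ∞` with `M > 1` fixed removes the tail, and only then `M →
  -- 1`.
  have hlower : ∀ M > 1, 1 ≤ M * f.real Set.univ := by
    intro M hM
    have h1 := (hI.const_mul M).add ((tendsto_rpow_neg_mul_rpow hκ hM hc C).comp hp)
    rw [add_zero] at h1
    refine ge_of_tendsto h1 ?_
    filter_upwards [hp1, hlt] with n hn hn'
    exact (hpair n).one_le_integral_rpow_sub_one hΩ hκ hC hn hc hM hn'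
  have hlower1 : 1 ≤ f.real Set.univ := by
    have ht : Tendsto (fun M : ℝ => M * f.real Set.univ) (𝓝[>] 1) (𝓝 (1 * f.real Set.univ)) :=
      ((continuous_id.mul continuous_const).tendsto 1).mono_left nhdsWithin_le_nhds
    rw [one_mul] at ht
    exact ge_of_tendsto ht (by filter_upwards [self_mem_nhdsWithin] with M hM using hlower M hM)
  refine ⟨?_⟩
  rw [← ENNReal.ofReal_toReal (measure_ne_top f Set.univ), ← measureReal_def,
    le_antisymm hupper hlower1, ENNReal.ofReal_one]

/-- The energy identity and the normalization give `lam = ∫ ‖∇u‖^p ≥ 0` for large exponents. -/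
theorem IsLimitAsPToInfty.nonneg {N : ℕ} {Ω : Opens (RN N)} {f : Measure (RN N)} {Λ : ℝ}
    (hlim : IsLimitAsPToInfty Ω f Λ) : 0 ≤ Λ := by
  obtain ⟨-, -, p, lam, u, -, hp, hpair, hlam, -⟩ := hlim
  refine ge_of_tendsto hlam ?_
  filter_upwards [hp.eventually_gt_atTop 1] with n hn
  obtain ⟨G, hu, heq⟩ := (hpair n).isSolution
  have hG := IsPLaplaceSolution.integral_norm_rpow_eq hn hu heq
  rw [(hpair n).integral_abs_rpow, mul_one] at hG
  exact Real.rpow_nonneg (hG ▸ integral_nonneg fun x => by positivity) _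

theorem IsLimitAsPToInfty.nonempty {N : ℕ} {Ω : Opens (RN N)} {f : Measure (RN N)} {Λ : ℝ}
    (hlim : IsLimitAsPToInfty Ω f Λ) : (Ω : Set (RN N)).Nonempty := by
  obtain ⟨-, -, p, lam, u, -, -, hpair, -, -⟩ := hlim
  by_contra h
  have h1 := (hpair 0).normalized
  rw [Set.not_nonempty_iff_eq_empty.1 h] at h1
  simp at h1

theorem mainTheorem6 {N : ℕ} (hN : 0 < N) (Ω : Opens (RN N))
    (hΩ : Bornology.IsBounded (Ω : Set (RN N)))
    (f : Measure (RN N)) (Λ : ℝ) (hlim : IsLimitAsPToInfty Ω f Λ) :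
    ∃ m : ℝ,
      IsLeast (primalValues Ω f Λ) (-m) ∧
      (∀ ν : Measure (RN N), IsBoundaryProbability Ω ν → ∃ mν : ℝ, IsLeast (dualValues f Λ ν) mν) ∧
      IsLeast (dualMinima Ω f Λ) m ∧
      IsLeast (dualSupportedValues Ω f Λ) m := by
  have := hlim.isProbabilityMeasure hN hΩ
  exact duality_of_isProbabilityMeasure hN Ω hΩ hlim.nonempty f hlim.2.1 hlim.nonneg
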